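/- A local computation algorithm (LCA) for graphs on the vertex set $[n]$ is given a query $(u,v)\in[n]^2$ and a tape $r$ of finitely many uniformly random bits, and has access to an input graph $G$, stored by adjacency lists in an arbitrary order, only through the following adaptive probes: $\mathtt{Exists}(a,b)$ (is $ab$ an edge of $G$?), $\mathtt{Deg}(a)$ (the degree of $a$) and $\mathtt{Nbr}(a,i)$ (the $i$-th entry of the adjacency list of $a$, or $\bot$ if there is none). It answers yes or no; the answer depends only on $G$ and its lists, $r$ and $(u,v)$ (no memory is kept between queries). Its worst-case probe complexity is the maximum, over all input graphs on $[n]$ with all orders of their adjacency lists and over all queries, of the expected number of probes over the random tape. Let $G(n,p)$ be the random graph on $[n]$ in which each pair is an edge independently with probability $p$, and let $\log$ be the natural logarithm. **Theorem.** There are constants $C>0$, $k\in\mathbb N$, $n_0$ and a function $\varepsilon(n)=o(n)$ such that for every $n\ge n_0$ and every $p$ with $7\log n/n\le p\le 1$ there is an LCA with the following properties. 1. With probability at least $1-1/n$ over $G\leftarrow G(n,p)$, for every order of the adjacency lists of $G$ and every tape $r$, there is a subgraph $H\subseteq G$ that is connected, contains all $n$ vertices and has at most $n+\varepsilon(n)$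 edges, such that for all $u,v$ the LCA answers the query $(u,v)$ with yes if and only if $uv$ is an edge of $H$. 2. Its worst-case probe complexity is at most $C\,\Delta\,(\log n)^k$, where $\Delta=np$. -/

import Mathlib

open Filter Asymptotics

/-- The input of a local computation algorithm: a graph on the vertex set `[n]` stored by adjacency
lists. Each list enumerates the neighbourhood of its vertex without repetition, in an arbitrary
(in particular, not necessarily sorted) order. -/
structure GraphInput (n : ℕ) where
  graph : SimpleGraph (Fin n)
  nbrs : Fin n → List (Fin n)
  nodup : ∀ v, (nbrs v).Nodup
  mem_nbrs : ∀ v w, w ∈ nbrs v ↔ graph.Adj v w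

/-- The probes `Exists(u, v)`, `Deg(v)` and `Nbr(v, i)`. -/
inductive Probe (n : ℕ) where
  | edge (u v : Fin n)
  | deg (v : Fin n)
  | nbr (v : Fin n) (i : ℕ)

/-- The type of the answers to a probe. -/
def Probe.Answer {n : ℕ} : Probe n → Type
  | .edge _ _ => Bool
  | .deg _ => ℕ
  | .nbr _ _ => Option (Fin n)

open Classical in
/-- The answer of the input to a probe. List positions are counted from `0`; the answer to
`Nbr(v, i)` is `none` when the list of `v` has no position `i`. -/
noncomputable def GraphInput.answer {n : ℕ} (I : GraphInput n) : (q : Probe n) → q.Answer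
  | .edge u v => decide (I.graph.Adj u v)
  | .deg v => (I.nbrs v).length
  | .nbr v i => (I.nbrs v)[i]?

/-- An adaptive probing procedure with result in `α`: it stops with a result, or makes a probe and
continues depending on the answer. -/
inductive ProbeTree (n : ℕ) (α : Type) where
  | done (a : α) : ProbeTree n α
  | ask (q : Probe n) (next : q.Answer → ProbeTree n α) : ProbeTree n α

/-- The result of a probing procedure on an input. -/
noncomputable def ProbeTree.run {n : ℕ} {α : Type} (I : GraphInput n) : ProbeTree n α → α
  | .done a => a
  | .ask q next => (next (I.answer q)).run I

/-- The number of probes that a probing procedure makes on an input. -/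
noncomputable def ProbeTree.probes {n : ℕ} {α : Type} (I : GraphInput n) : ProbeTree n α → ℕ
  | .done _ => 0
  | .ask q next => (next (I.answer q)).probes I + 1

/-- A local computation algorithm on `n`-vertex graphs for queries "is `(u, v)` in `H`?". It has a
read-only tape of random bits. It is memoryless: the procedure that answers a query depends on the
tape and on the query only. -/
structure LCA (n : ℕ) where
  tapeLength : ℕ
  procedure : (Fin tapeLength → Bool) → Fin n × Fin n → ProbeTree n Bool

namespace LCA

variable {n : ℕ}

/-- The answer to the query `q` on input `I` with random tape `r`. -/
noncomputable def output (A : LCA n) (I : GraphInput n) (r : Fin A.tapeLength → Bool)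
    (q : Fin n × Fin n) : Bool :=
  (A.procedure r q).run I

/-- The expected number of probes, over a uniformly random tape, made to answer `q` on input `I`. -/
noncomputable def expectedProbes (A : LCA n) (I : GraphInput n) (q : Fin n × Fin n) : ℝ :=
  (∑ r : Fin A.tapeLength → Bool, ((A.procedure r q).probes I : ℝ)) / 2 ^ A.tapeLength

/-- The probe complexity on input `I`: the maximum over all queries of the expected number of
probes. -/
noncomputable def probeComplexity (A : LCA n) (I : GraphInput n) : ℝ :=
  ⨆ q : Fin n × Fin n, A.expectedProbes I q

/-- The worst-case probe complexity is at most `T`: the bound holds on every input. -/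
def WorstCaseProbeComplexityLE (A : LCA n) (T : ℝ) : Prop :=
  ∀ I : GraphInput n, A.probeComplexity I ≤ T

/-- `A` solves the subgraph problem `Prob` on input `I`: for every random tape, the answers to all
queries are consistent with a single valid solution `H`. -/
def Solves (A : LCA n) (Prob : SimpleGraph (Fin n) → SimpleGraph (Fin n) → Prop)
    (I : GraphInput n) : Prop :=
  ∀ r : Fin A.tapeLength → Bool, ∃ H : SimpleGraph (Fin n),
    Prob I.graph H ∧ ∀ u v : Fin n, A.output I r (u, v) = true ↔ H.Adj u v

/-- `A` is an average-case local computation algorithm for the subgraph problem `Prob` on the random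
graph `G(n, p)`: with probability at least `1 - 1/n` over the graph, `A` solves the problem on that
graph, whatever the order of its adjacency lists. -/
def IsAverageCase (A : LCA n) (p : unitInterval)
    (Prob : SimpleGraph (Fin n) → SimpleGraph (Fin n) → Prop) : Prop :=
  1 - 1 / (n : ℝ) ≤ (SimpleGraph.binomialRandom (Fin n) p).real
    {G | ∀ J : GraphInput n, J.graph = G → A.Solves Prob J}

end LCA

/-- `H` is a connected subgraph of `G` on all the vertices of `G`, with at most `m` edges. -/
def SparseConnectedSubgraph {n : ℕ} (m : ℝ) (G H : SimpleGraph (Fin n)) : Prop :=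
  H ≤ G ∧ H.Connected ∧ (H.edgeSet.ncard : ℝ) ≤ m

/-! The algorithm uses no randomness. Fix disjoint vertex sets, a core `X` of about `k / p` vertices
and a relay set `Y` of about `5 log n / p` vertices, chosen without looking at `G`. Keep every edge
inside `X`, and let each vertex keep one edge to a parent. A vertex of `X` is good when its
component in `G[X]` has at least `s ≈ log n` vertices. A vertex of `Y` with a good neighbour takes
one as its parent; every other vertex takes as parent a neighbour in `Y` that has a good neighbour.

Connectivity: with high probability no component of `G[X]` has size between `s` and `|X| / 2`
(`binomialRandom_real_not_noMediumComponent_le`, a union bound over spanning trees), so all good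
vertices lie in one component. At least half of `X` is good, because `G[X]` has no balanced cut
(`card_le_two_mul_card_goods`). Goodness depends only on the edges inside `X`, so the edges from `v`
to `Y` and from `Y` to the good vertices are still random; hence every `v` has a relay
(`binomialRandom_real_relays_empty_le`) and reaches the large component in at most two steps.

Size: parents contribute at most `n` edges and the core about `p |X|² ≈ k² / p`, which is `o(n)` for
the `k` of `exists_core_density`.

Probes: degrees are `O(np)`, while degrees into `X` and `Y` are `O(log n)`. A goodness test explores
fewer than `s` vertices in each of `s` rounds, and one query needs `O(log² n)` such tests, in total
`O(np log⁴ n)` probes. Truncation at this budget makes the bound hold on every input and changes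
nothing on typical graphs. Every choice depends on neighbourhoods as sets, so the list order does
not affect `H`. -/

namespace ProbeTree

/-! ### Combinators for probing procedures and their costs. -/

variable {n : ℕ} {α β : Type}

/-- Sequential composition of probing procedures. -/
def bind : ProbeTree n α → (α → ProbeTree n β) → ProbeTree n β
  | .done a, f => f a
  | .ask q next, f => .ask q fun r => (next r).bind f

theorem run_bind (I : GraphInput n) (t : ProbeTree n α) (f : α → ProbeTree n β) :
    (t.bind f).run I = (f (t.run I)).run I := by
  induction t with
  | done a => rfl
  | ask q next ih => exact ih _

theorem probes_bind (I : GraphInput n) (t : ProbeTree n α) (f : α → ProbeTree n β) :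
    (t.bind f).probes I = t.probes I + (f (t.run I)).probes I := by
  induction t with
  | done a => simp [bind, probes, run]
  | ask q next ih =>
    simp only [bind, probes, run, ih]
    omega

/-- The procedure that gives up with result `d` when it would make more than `b` probes. -/
def trunc (d : α) : ℕ → ProbeTree n α → ProbeTree n α
  | _, .done a => .done a
  | 0, .ask _ _ => .done d
  | b + 1, .ask q next => .ask q fun r => trunc d b (next r)

theorem probes_trunc_le (I : GraphInput n) (d : α) (b : ℕ) (t : ProbeTree n α) :
    (trunc d b t).probes I ≤ b := by
  induction t generalizing b with
  | done a => simp [trunc, probes]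
  | ask q next ih =>
    cases b with
    | zero => simp [trunc, probes]
    | succ b => simpa [trunc, probes] using ih _ b

theorem run_trunc (I : GraphInput n) (d : α) (b : ℕ) (t : ProbeTree n α)
    (h : t.probes I ≤ b) : (trunc d b t).run I = t.run I := by
  induction t generalizing b with
  | done a => simp [trunc, run]
  | ask q next ih =>
    cases b with
    | zero => simp [probes] at h
    | succ b =>
      simp only [probes, Nat.add_le_add_iff_right] at h
      simpa [trunc, run] using ih _ b h

/-- Union of the results of a procedure over a list of vertices. -/
def unions (f : Fin n → ProbeTree n (Finset (Fin n))) : List (Fin n) → ProbeTree n (Finset (Fin n))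
  | [] => .done ∅
  | v :: l => (f v).bind fun s => (unions f l).bind fun t => .done (s ∪ t)

theorem run_unions (I : GraphInput n) (f : Fin n → ProbeTree n (Finset (Fin n)))
    (l : List (Fin n)) : (unions f l).run I = l.toFinset.biUnion fun v => (f v).run I := by
  induction l with
  | nil => simp [unions, run]
  | cons v l ih => simp [unions, run_bind, run, ih, Finset.biUnion_insert]

theorem probes_unions_le (I : GraphInput n) (f : Fin n → ProbeTree n (Finset (Fin n)))
    (l : List (Fin n)) (b : ℕ) (h : ∀ v ∈ l, (f v).probes I ≤ b) :
    (unions f l).probes I ≤ l.length * b := by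
  induction l with
  | nil => simp [unions, probes]
  | cons v l ih =>
    simp only [unions, probes_bind, probes, List.length_cons, add_zero]
    have h1 := h v (by simp)
    have h2 := ih fun w hw => h w (by simp [hw])
    linarith [add_mul l.length 1 b]

/-- The vertices of a finite set that pass a test. -/
noncomputable def select (f : Fin n → ProbeTree n Bool) (s : Finset (Fin n)) :
    ProbeTree n (Finset (Fin n)) :=
  unions (fun v => (f v).bind fun b => .done (if b then {v} else ∅)) s.toList

theorem run_select (I : GraphInput n) (f : Fin n → ProbeTree n Bool) (s : Finset (Fin n)) :
    (select f s).run I = s.filter fun v => (f v).run I = true := by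
  ext w
  simp only [select, run_unions, run_bind, run, Finset.mem_biUnion, Finset.toList_toFinset,
    Finset.mem_filter]
  constructor
  · rintro ⟨v, hv, hw⟩
    split_ifs at hw with h
    · rw [Finset.mem_singleton] at hw
      exact hw ▸ ⟨hv, h⟩
    · simp at hw
  · rintro ⟨hw, h⟩
    exact ⟨w, hw, by simp [h]⟩

theorem probes_select_le (I : GraphInput n) (f : Fin n → ProbeTree n Bool) (s : Finset (Fin n))
    (b : ℕ) (h : ∀ v ∈ s, (f v).probes I ≤ b) : (select f s).probes I ≤ s.card * b := by
  rw [← Finset.length_toList]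
  refine probes_unions_le I _ _ b fun v hv => ?_
  simpa [probes_bind, probes] using h v (by simpa using hv)

/-- The set of the first `d` entries of the adjacency list of `v`. -/
def readFirst (v : Fin n) : ℕ → ProbeTree n (Finset (Fin n))
  | 0 => .done ∅
  | i + 1 => .ask (.nbr v i) fun (o : Option (Fin n)) =>
      (readFirst v i).bind fun s => .done (s ∪ o.toFinset)

/-- The neighbourhood of `v`. -/
def readNbrs (v : Fin n) : ProbeTree n (Finset (Fin n)) :=
  .ask (.deg v) fun (d : ℕ) => readFirst v d

theorem run_readFirst (I : GraphInput n) (v : Fin n) (d : ℕ) :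
    (readFirst v d).run I = ((I.nbrs v).take d).toFinset := by
  induction d with
  | zero => simp [readFirst, run]
  | succ d ih =>
    simp only [readFirst, run, run_bind, ih, List.take_add_one, List.toFinset_append]
    congr 1
    simp only [GraphInput.answer]
    cases (I.nbrs v)[d]? <;> simp

theorem probes_readFirst (I : GraphInput n) (v : Fin n) (d : ℕ) :
    (readFirst v d).probes I = d := by
  induction d with
  | zero => simp [readFirst, probes]
  | succ d ih => simp [readFirst, probes, probes_bind, ih]

end ProbeTree

open Classical in
/-- The neighbourhood of a vertex as a finite set. -/
noncomputable def nbhd {n : ℕ} (G : SimpleGraph (Fin n)) (v : Fin n) : Finset (Fin n) :=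
  Finset.univ.filter fun w => G.Adj v w

@[simp]
theorem mem_nbhd {n : ℕ} {G : SimpleGraph (Fin n)} {v w : Fin n} :
    w ∈ nbhd G v ↔ G.Adj v w := by
  simp [nbhd]

namespace ProbeTree

variable {n : ℕ}

theorem nbhd_eq (I : GraphInput n) (v : Fin n) : nbhd I.graph v = (I.nbrs v).toFinset := by
  ext w
  simp [I.mem_nbrs]

theorem run_readNbrs (I : GraphInput n) (v : Fin n) :
    (readNbrs v).run I = nbhd I.graph v := by
  simp only [readNbrs, run, run_readFirst, nbhd_eq, GraphInput.answer, List.take_length]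

theorem probes_readNbrs (I : GraphInput n) (v : Fin n) :
    (readNbrs v).probes I = (nbhd I.graph v).card + 1 := by
  simp only [readNbrs, probes, probes_readFirst, nbhd_eq, GraphInput.answer,
    List.toFinset_card_of_nodup (I.nodup v)]

end ProbeTree

/-! ### The sparse subgraph and its deterministic properties. -/

section Structure

variable {n : ℕ}

/-- The edges of `G` inside `X`, as a graph on all vertices. -/
def within (G : SimpleGraph (Fin n)) (X : Finset (Fin n)) : SimpleGraph (Fin n) where
  Adj u v := G.Adj u v ∧ u ∈ X ∧ v ∈ X
  symm := ⟨fun _ _ h => ⟨h.1.symm, h.2.2, h.2.1⟩⟩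
  loopless := ⟨fun _ h => G.loopless.irrefl _ h.1⟩

/-- No edge of `G` inside `X` leaves the subset `S` of `X`. -/
def ClosedIn (G : SimpleGraph (Fin n)) (X S : Finset (Fin n)) : Prop :=
  S ⊆ X ∧ ∀ x ∈ S, ∀ y ∈ X, G.Adj x y → y ∈ S

/-- One step of a breadth-first search in `X`, which stops growing at size `s`. -/
noncomputable def grow (G : SimpleGraph (Fin n)) (X : Finset (Fin n)) (s : ℕ)
    (A : Finset (Fin n)) : Finset (Fin n) :=
  if s ≤ A.card then A else A ∪ A.biUnion (nbhd G) ∩ X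

/-- The set reached from `x` in `X` by `i` steps of the search that stops at size `s`. -/
noncomputable def searchBall (G : SimpleGraph (Fin n)) (X : Finset (Fin n)) (s : ℕ) (x : Fin n) :
    ℕ → Finset (Fin n)
  | 0 => {x}
  | i + 1 => grow G X s (searchBall G X s x i)

/-- The component of `x` in `X` has at least `s` vertices, as seen by the local search. -/
def IsGood (G : SimpleGraph (Fin n)) (X : Finset (Fin n)) (s : ℕ) (x : Fin n) : Prop :=
  s ≤ (searchBall G X s x s).card

open Classical in
/-- The good vertices of `X`. -/
noncomputable def goods (G : SimpleGraph (Fin n)) (X : Finset (Fin n)) (s : ℕ) :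
    Finset (Fin n) :=
  X.filter (IsGood G X s)

/-- The good neighbours of `v` in `X`. -/
noncomputable def goodNbrs (G : SimpleGraph (Fin n)) (X : Finset (Fin n)) (s : ℕ) (v : Fin n) :
    Finset (Fin n) :=
  nbhd G v ∩ goods G X s

/-- The neighbours of `v` in `Y` that have a good neighbour in `X`. -/
noncomputable def relays (G : SimpleGraph (Fin n)) (X Y : Finset (Fin n)) (s : ℕ) (v : Fin n) :
    Finset (Fin n) :=
  (nbhd G v ∩ Y).filter fun w => (goodNbrs G X s w).Nonempty

/-- Some element of a finite set, if there is one. -/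
noncomputable def pick (S : Finset (Fin n)) : Option (Fin n) :=
  if h : S.Nonempty then some h.choose else none

theorem mem_of_pick_eq_some {S : Finset (Fin n)} {v : Fin n} (h : pick S = some v) : v ∈ S := by
  unfold pick at h
  split_ifs at h with hS
  rw [← Option.some.inj h]
  exact hS.choose_spec

theorem exists_pick {S : Finset (Fin n)} (h : S.Nonempty) : ∃ v ∈ S, pick S = some v :=
  ⟨h.choose, h.choose_spec, by simp [pick, h]⟩

open Classical in
/-- The vertex that `v` connects to: a good neighbour if `v` is a relay, a relay otherwise. -/
noncomputable def parent (G : SimpleGraph (Fin n)) (X Y : Finset (Fin n)) (s : ℕ) (v : Fin n) :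
    Option (Fin n) :=
  if v ∈ Y ∧ (goodNbrs G X s v).Nonempty then pick (goodNbrs G X s v)
  else pick (relays G X Y s v)

/-- All edges inside `X`, and the edges from the vertices to their parents. -/
def sparseSubgraph (G : SimpleGraph (Fin n)) (X Y : Finset (Fin n)) (s : ℕ) :
    SimpleGraph (Fin n) where
  Adj u v := G.Adj u v ∧
    ((u ∈ X ∧ v ∈ X) ∨ parent G X Y s u = some v ∨ parent G X Y s v = some u)
  symm := ⟨fun _ _ h => ⟨h.1.symm, by tauto⟩⟩
  loopless := ⟨fun _ h => G.loopless.irrefl _ h.1⟩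

open Classical in
/-- The connected component of `x` in the graph inside `X`. -/
noncomputable def compIn (G : SimpleGraph (Fin n)) (X : Finset (Fin n)) (x : Fin n) :
    Finset (Fin n) :=
  Finset.univ.filter fun y => (within G X).Reachable x y

theorem mem_compIn {G : SimpleGraph (Fin n)} {X : Finset (Fin n)} {x y : Fin n} :
    y ∈ compIn G X x ↔ (within G X).Reachable x y := by
  simp [compIn]

theorem compIn_subset {G : SimpleGraph (Fin n)} {X : Finset (Fin n)} {x : Fin n} (hx : x ∈ X) :
    compIn G X x ⊆ X := by
  intro y hy
  obtain ⟨w⟩ := mem_compIn.1 hy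
  clear hy
  induction w with
  | nil => exact hx
  | cons h _ ih => exact ih h.2.2

theorem closedIn_compIn {G : SimpleGraph (Fin n)} {X : Finset (Fin n)} {x : Fin n} (hx : x ∈ X) :
    ClosedIn G X (compIn G X x) := by
  refine ⟨compIn_subset hx, fun y hy z hz h => ?_⟩
  have hyX := compIn_subset hx hy
  rw [mem_compIn] at hy ⊢
  exact hy.trans (SimpleGraph.Adj.reachable (G := within G X) ⟨h, hyX, hz⟩)

theorem searchBall_subset_compIn {G : SimpleGraph (Fin n)} {X : Finset (Fin n)} {s : ℕ}
    {x : Fin n} (hx : x ∈ X) (i : ℕ) : searchBall G X s x i ⊆ compIn G X x := by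
  induction i with
  | zero => simp [searchBall, mem_compIn]
  | succ i ih =>
    unfold searchBall grow
    split_ifs
    · exact ih
    · refine Finset.union_subset ih fun y hy => ?_
      simp only [Finset.mem_inter, Finset.mem_biUnion, mem_nbhd] at hy
      obtain ⟨⟨z, hz, hzy⟩, hyX⟩ := hy
      exact (closedIn_compIn hx).2 z (ih hz) y hyX hzy

theorem mem_searchBall (G : SimpleGraph (Fin n)) (X : Finset (Fin n)) (s : ℕ)
    (x : Fin n) (i : ℕ) : x ∈ searchBall G X s x i := by
  induction i with
  | zero => simp [searchBall]
  | succ i ih =>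
    unfold searchBall grow
    split_ifs
    · exact ih
    · exact Finset.mem_union_left _ ih

/-- A round below size `s` adds a vertex unless the set is already closed. Thus `s` rounds decide
goodness. -/
theorem searchBall_progress {G : SimpleGraph (Fin n)} {X : Finset (Fin n)} {s : ℕ}
    {x : Fin n} (hx : x ∈ X) (i : ℕ) :
    s ≤ (searchBall G X s x i).card ∨ i < (searchBall G X s x i).card ∨
      ClosedIn G X (searchBall G X s x i) := by
  induction i with
  | zero => simp [searchBall]
  | succ i ih =>
    have hsub := (searchBall_subset_compIn (G := G) (s := s) hx i).trans (compIn_subset hx)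
    rw [searchBall]
    generalize searchBall G X s x i = A at ih hsub
    by_cases hs : s ≤ A.card
    · left; simp [grow, hs]
    by_cases hc : ClosedIn G X A
    · right; right
      have : A.biUnion (nbhd G) ∩ X ⊆ A := by
        intro y hy
        simp only [Finset.mem_inter, Finset.mem_biUnion, mem_nbhd] at hy
        obtain ⟨⟨z, hz, hzy⟩, hyX⟩ := hy
        exact hc.2 z hz y hyX hzy
      simpa [grow, hs, Finset.union_eq_left.2 this] using hc
    · right; left
      have hi : i < A.card := by tauto
      have : ∃ z ∈ A, ∃ y ∈ X, G.Adj z y ∧ y ∉ A := by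
        by_contra hcon
        push Not at hcon
        exact hc ⟨hsub, hcon⟩
      obtain ⟨z, hz, y, hy, hzy, hyA⟩ := this
      have hlt : A.card < (grow G X s A).card := by
        refine Finset.card_lt_card ?_
        rw [Finset.ssubset_iff_of_subset (by simp [grow, hs])]
        refine ⟨y, ?_, hyA⟩
        simp only [grow, hs, if_false, Finset.mem_union, Finset.mem_inter, Finset.mem_biUnion,
          mem_nbhd]
        exact Or.inr ⟨⟨z, hz, hzy⟩, hy⟩
      omega

theorem IsGood.le_card_compIn {G : SimpleGraph (Fin n)} {X : Finset (Fin n)} {s : ℕ} {x : Fin n}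
    (hx : x ∈ X) (h : IsGood G X s x) : s ≤ (compIn G X x).card :=
  h.trans (Finset.card_le_card (searchBall_subset_compIn hx s))

theorem exists_closedIn_of_not_isGood {G : SimpleGraph (Fin n)} {X : Finset (Fin n)} {s : ℕ}
    {x : Fin n} (hx : x ∈ X) (h : ¬ IsGood G X s x) :
    ∃ A, x ∈ A ∧ A.card < s ∧ ClosedIn G X A := by
  refine ⟨_, mem_searchBall G X s x s, not_le.1 h, ?_⟩
  unfold IsGood at h
  rcases searchBall_progress (G := G) (s := s) hx s with h' | h' | h'
  · exact absurd h' h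
  · exact absurd h'.le h
  · exact h'

theorem ClosedIn.union {G : SimpleGraph (Fin n)} {X S T : Finset (Fin n)} (hS : ClosedIn G X S)
    (hT : ClosedIn G X T) : ClosedIn G X (S ∪ T) := by
  refine ⟨Finset.union_subset hS.1 hT.1, fun x hx y hy h => ?_⟩
  rcases Finset.mem_union.1 hx with hx | hx
  · exact Finset.mem_union_left _ (hS.2 x hx y hy h)
  · exact Finset.mem_union_right _ (hT.2 x hx y hy h)

/-- No component inside `X` has size between `s` and `|X| / 2`. -/
def NoMediumComponent (G : SimpleGraph (Fin n)) (X : Finset (Fin n)) (s : ℕ) : Prop :=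
  ∀ x ∈ X, s ≤ (compIn G X x).card → X.card < 2 * (compIn G X x).card

/-- No closed subset of `X` has size between `|X| / 4` and `|X| / 2`. -/
def NoBalancedCut (G : SimpleGraph (Fin n)) (X : Finset (Fin n)) : Prop :=
  ∀ S, ClosedIn G X S → X.card ≤ 4 * S.card → X.card < 2 * S.card

/-- Take a largest closed set `S` with at most `|X| / 2` vertices; having no balanced cut, it has
fewer than `|X| / 4`. If the bad vertices were more than half of `X`, one of them would lie outside
`S`, and adding its closed set of size below `s ≤ |X| / 4` would contradict maximality. -/
theorem card_le_two_mul_card_goods {G : SimpleGraph (Fin n)} {X : Finset (Fin n)} {s : ℕ}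
    (hs : 4 * s ≤ X.card) (h : NoBalancedCut G X) : X.card ≤ 2 * (goods G X s).card := by
  classical
  by_contra hcon
  have hne : ((Finset.univ : Finset (Finset (Fin n))).filter
      fun S => ClosedIn G X S ∧ 2 * S.card ≤ X.card).Nonempty :=
    ⟨∅, Finset.mem_filter.2 ⟨Finset.mem_univ _, ⟨by simp, by simp⟩, by simp⟩⟩
  obtain ⟨S, hS, hmax⟩ := Finset.exists_max_image _ Finset.card hne
  simp only [Finset.mem_filter, Finset.mem_univ, true_and] at hS hmax
  have h4 : 4 * S.card < X.card := by
    by_contra h4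
    have := h S hS.1 (not_lt.1 h4)
    omega
  have hex : ∃ x ∈ X \ goods G X s, x ∉ S := by
    by_contra hsub
    push Not at hsub
    have h1 := Finset.card_le_card (show X \ goods G X s ⊆ S from hsub)
    have h2 := Finset.card_sdiff_add_card_eq_card
      (show goods G X s ⊆ X from Finset.filter_subset _ _)
    omega
  obtain ⟨x, hx, hxS⟩ := hex
  simp only [goods, Finset.mem_sdiff, Finset.mem_filter, not_and] at hx
  obtain ⟨A, hxA, hAs, hA⟩ := exists_closedIn_of_not_isGood hx.1 (hx.2 hx.1)
  have h1 := Finset.card_union_le S A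
  have h2 := hmax (S ∪ A) ⟨hS.1.union hA, by omega⟩
  have h3 : S.card < (S ∪ A).card := Finset.card_lt_card <| by
    rw [Finset.ssubset_iff_of_subset Finset.subset_union_left]
    exact ⟨x, Finset.mem_union_right _ hxA, hxS⟩
  omega

/-- Both components contain more than half of `X`, so they meet. -/
theorem reachable_of_mem_goods {G : SimpleGraph (Fin n)} {X : Finset (Fin n)} {s : ℕ}
    (h : NoMediumComponent G X s) {x y : Fin n} (hx : x ∈ goods G X s) (hy : y ∈ goods G X s) :
    (within G X).Reachable x y := by
  simp only [goods, Finset.mem_filter] at hx hy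
  have h1 := h x hx.1 (hx.2.le_card_compIn hx.1)
  have h2 := h y hy.1 (hy.2.le_card_compIn hy.1)
  by_contra hcon
  have hd : Disjoint (compIn G X x) (compIn G X y) := by
    rw [Finset.disjoint_left]
    intro z hz hz'
    exact hcon ((mem_compIn.1 hz).trans (mem_compIn.1 hz').symm)
  have h3 := Finset.card_le_card (Finset.union_subset (compIn_subset (G := G) hx.1)
    (compIn_subset (G := G) hy.1))
  rw [Finset.card_union_of_disjoint hd] at h3
  omega

theorem adj_of_parent_eq_some {G : SimpleGraph (Fin n)} {X Y : Finset (Fin n)} {s : ℕ}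
    {v w : Fin n} (h : parent G X Y s v = some w) : (sparseSubgraph G X Y s).Adj v w := by
  refine ⟨?_, Or.inr (Or.inl h)⟩
  unfold parent at h
  split_ifs at h
  · have := mem_of_pick_eq_some h
    simp only [goodNbrs, Finset.mem_inter, mem_nbhd] at this
    exact this.1
  · have := mem_of_pick_eq_some h
    simp only [relays, Finset.mem_filter, Finset.mem_inter, mem_nbhd] at this
    exact this.1.1

/-- Following parents leads to a good vertex in one or two steps, and good vertices are joined
inside `X`. Vertices of `X` are treated like all others, since their own component may be small. -/
theorem sparseSubgraph_connected {G : SimpleGraph (Fin n)} {X Y : Finset (Fin n)} {s : ℕ}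
    (hn : 0 < n) (h : NoMediumComponent G X s) (hr : ∀ v, (relays G X Y s v).Nonempty) :
    (sparseSubgraph G X Y s).Connected := by
  have key : ∀ v, ∃ x ∈ goods G X s, (sparseSubgraph G X Y s).Reachable v x := by
    have relay : ∀ v ∈ Y, (goodNbrs G X s v).Nonempty →
        ∃ x ∈ goods G X s, (sparseSubgraph G X Y s).Reachable v x := by
      intro v hv hg
      obtain ⟨x, hx, hp⟩ := exists_pick hg
      refine ⟨x, (Finset.mem_inter.1 hx).2, (adj_of_parent_eq_some ?_).reachable⟩
      simp [parent, hv, hg, hp]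
    intro v
    by_cases hv : v ∈ Y ∧ (goodNbrs G X s v).Nonempty
    · exact relay v hv.1 hv.2
    · obtain ⟨w, hw, hp⟩ := exists_pick (hr v)
      have hadj : (sparseSubgraph G X Y s).Adj v w := adj_of_parent_eq_some (by simp [parent, hv, hp])
      simp only [relays, Finset.mem_filter, Finset.mem_inter] at hw
      obtain ⟨x, hx, hwx⟩ := relay w hw.1.2 hw.2
      exact ⟨x, hx, hadj.reachable.trans hwx⟩
  have hle : within G X ≤ sparseSubgraph G X Y s := fun u v huv => ⟨huv.1, Or.inl huv.2⟩
  have : Nonempty (Fin n) := ⟨⟨0, hn⟩⟩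
  refine ⟨fun u v => ?_⟩
  obtain ⟨x, hx, hux⟩ := key u
  obtain ⟨y, hy, hvy⟩ := key v
  exact hux.trans (((reachable_of_mem_goods h hx hy).mono hle).trans hvy.symm)

theorem ncard_edgeSet_sparseSubgraph_le (G : SimpleGraph (Fin n)) (X Y : Finset (Fin n)) (s : ℕ) :
    (sparseSubgraph G X Y s).edgeSet.ncard ≤ n + (within G X).edgeSet.ncard := by
  -- A vertex without a parent is sent to a loop, which is harmless in an upper bound.
  have hsub : (sparseSubgraph G X Y s).edgeSet ⊆
      Set.range (fun v : Fin n => s(v, (parent G X Y s v).getD v)) ∪ (within G X).edgeSet := by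
    intro e
    induction e with
    | h u v =>
      rintro ⟨h, hX | hp | hp⟩
      · exact Or.inr ⟨h, hX⟩
      · exact Or.inl ⟨u, by simp [hp]⟩
      · exact Or.inl ⟨v, by simp [hp, Sym2.eq_swap]⟩
  refine (Set.ncard_le_ncard hsub (Set.toFinite _)).trans ((Set.ncard_union_le _ _).trans ?_)
  gcongr
  rw [← Set.image_univ]
  exact (Set.ncard_image_le (Set.toFinite _)).trans (by simp)

theorem sparseConnectedSubgraph_sparseSubgraph {G : SimpleGraph (Fin n)} {X Y : Finset (Fin n)}
    {s : ℕ} {r : ℝ} (hn : 0 < n) (h : NoMediumComponent G X s)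
    (hr : ∀ v, (relays G X Y s v).Nonempty) (he : ((within G X).edgeSet.ncard : ℝ) ≤ r) :
    SparseConnectedSubgraph ((n : ℝ) + r) G (sparseSubgraph G X Y s) := by
  refine ⟨fun u v huv => huv.1, sparseSubgraph_connected hn h hr, ?_⟩
  have : ((sparseSubgraph G X Y s).edgeSet.ncard : ℝ) ≤ n + (within G X).edgeSet.ncard :=
    mod_cast ncard_edgeSet_sparseSubgraph_le G X Y s
  linarith

end Structure

/-! ### Procedures computing the sparse subgraph, with probe counts. -/

namespace ProbeTree

variable {n : ℕ}

/-- The procedure computing `grow`. -/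
noncomputable def growProc (X : Finset (Fin n)) (s : ℕ) (A : Finset (Fin n)) :
    ProbeTree n (Finset (Fin n)) :=
  if s ≤ A.card then .done A
  else (unions readNbrs A.toList).bind fun N => .done (A ∪ N ∩ X)

/-- The procedure computing `searchBall`. -/
noncomputable def searchBallProc (X : Finset (Fin n)) (s : ℕ) (x : Fin n) :
    ℕ → ProbeTree n (Finset (Fin n))
  | 0 => .done {x}
  | i + 1 => (searchBallProc X s x i).bind (growProc X s)

/-- The procedure deciding `IsGood`. -/
noncomputable def isGoodProc (X : Finset (Fin n)) (s : ℕ) (x : Fin n) : ProbeTree n Bool :=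
  (searchBallProc X s x s).bind fun A => .done (decide (s ≤ A.card))

/-- The procedure computing `goodNbrs`. -/
noncomputable def goodNbrsProc (X : Finset (Fin n)) (s : ℕ) (v : Fin n) :
    ProbeTree n (Finset (Fin n)) :=
  (readNbrs v).bind fun N => select (isGoodProc X s) (N ∩ X)

/-- The procedure computing `relays`. -/
noncomputable def relaysProc (X Y : Finset (Fin n)) (s : ℕ) (v : Fin n) :
    ProbeTree n (Finset (Fin n)) :=
  (readNbrs v).bind fun N =>
    select (fun w => (goodNbrsProc X s w).bind fun S => .done (decide S.Nonempty)) (N ∩ Y)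

open Classical in
/-- The procedure computing `parent`. -/
noncomputable def parentProc (X Y : Finset (Fin n)) (s : ℕ) (v : Fin n) :
    ProbeTree n (Option (Fin n)) :=
  (goodNbrsProc X s v).bind fun S =>
    if v ∈ Y ∧ S.Nonempty then .done (pick S)
    else (relaysProc X Y s v).bind fun R => .done (pick R)

open Classical in
/-- The procedure deciding adjacency in `sparseSubgraph`. -/
noncomputable def adjProc (X Y : Finset (Fin n)) (s : ℕ) (u v : Fin n) : ProbeTree n Bool :=
  (readNbrs u).bind fun N => (parentProc X Y s u).bind fun a => (parentProc X Y s v).bind fun b =>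
    .done (decide (v ∈ N ∧ ((u ∈ X ∧ v ∈ X) ∨ a = some v ∨ b = some u)))

variable (I : GraphInput n) (X Y : Finset (Fin n)) (s : ℕ)

theorem run_growProc (A : Finset (Fin n)) : (growProc X s A).run I = grow I.graph X s A := by
  unfold growProc grow
  split_ifs
  · rfl
  · simp [run_bind, run_unions, run_readNbrs, run]

theorem run_searchBallProc (x : Fin n) (i : ℕ) :
    (searchBallProc X s x i).run I = searchBall I.graph X s x i := by
  induction i with
  | zero => rfl
  | succ i ih => simp [searchBallProc, searchBall, run_bind, ih, run_growProc]

theorem run_isGoodProc (x : Fin n) :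
    (isGoodProc X s x).run I = true ↔ IsGood I.graph X s x := by
  simp [isGoodProc, run_bind, run_searchBallProc, run, IsGood]

theorem run_goodNbrsProc (v : Fin n) :
    (goodNbrsProc X s v).run I = goodNbrs I.graph X s v := by
  ext x
  simp [goodNbrsProc, run_bind, run_readNbrs, run_select, run_isGoodProc, goodNbrs, goods,
    and_assoc]

theorem run_relaysProc (v : Fin n) :
    (relaysProc X Y s v).run I = relays I.graph X Y s v := by
  simp [relaysProc, run_bind, run_readNbrs, run_select, run_goodNbrsProc, relays, run]

theorem run_parentProc (v : Fin n) :
    (parentProc X Y s v).run I = parent I.graph X Y s v := by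
  simp only [parentProc, run_bind, run_goodNbrsProc, parent]
  split_ifs
  · rfl
  · simp [run_bind, run_relaysProc, run]

theorem run_adjProc (u v : Fin n) :
    (adjProc X Y s u v).run I = true ↔ (sparseSubgraph I.graph X Y s).Adj u v := by
  simp [adjProc, run_bind, run_readNbrs, run_parentProc, run, sparseSubgraph]

variable {I X Y s} {D a : ℕ}

/-- A set is expanded only while it has fewer than `s` elements. The extra 1 in `D` pays for the
degree probe. -/
theorem probes_growProc_le (hD : ∀ v, (nbhd I.graph v).card + 1 ≤ D)
    (A : Finset (Fin n)) : (growProc X s A).probes I ≤ s * D := by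
  unfold growProc
  split_ifs with h
  · simp [probes]
  · simp only [probes_bind, probes, add_zero]
    refine (probes_unions_le I _ _ D fun v _ => by rw [probes_readNbrs]; exact hD v).trans ?_
    rw [Finset.length_toList]
    exact Nat.mul_le_mul_right _ (not_le.1 h).le

theorem probes_searchBallProc_le (hD : ∀ v, (nbhd I.graph v).card + 1 ≤ D)
    (x : Fin n) (i : ℕ) :
    (searchBallProc X s x i).probes I ≤ i * (s * D) := by
  induction i with
  | zero => simp [searchBallProc, probes]
  | succ i ih =>
    rw [searchBallProc, probes_bind]
    have := probes_growProc_le (X := X) (s := s) hD ((searchBallProc X s x i).run I)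
    linarith [add_mul i 1 (s * D)]

theorem probes_isGoodProc_le (hD : ∀ v, (nbhd I.graph v).card + 1 ≤ D)
    (x : Fin n) : (isGoodProc X s x).probes I ≤ s * (s * D) := by
  simpa [isGoodProc, probes_bind, probes] using probes_searchBallProc_le hD x s

theorem probes_goodNbrsProc_le (hD : ∀ v, (nbhd I.graph v).card + 1 ≤ D)
    (hX : ∀ v, (nbhd I.graph v ∩ X).card ≤ a)
    (v : Fin n) :
    (goodNbrsProc X s v).probes I ≤ D * (1 + a * s * s) := by
  rw [goodNbrsProc, probes_bind, probes_readNbrs, run_readNbrs]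
  have h1 := probes_select_le I (isGoodProc X s) (nbhd I.graph v ∩ X) _
    fun x _ => probes_isGoodProc_le hD x
  have h2 := Nat.mul_le_mul_right (s * (s * D)) (hX v)
  have h3 : a * (s * (s * D)) = D * (a * s * s) := by ring
  rw [mul_add]
  linarith [hD v]

theorem probes_relaysProc_le (hD : ∀ v, (nbhd I.graph v).card + 1 ≤ D)
    (hX : ∀ v, (nbhd I.graph v ∩ X).card ≤ a) (hY : ∀ v, (nbhd I.graph v ∩ Y).card ≤ a)
    (v : Fin n) :
    (relaysProc X Y s v).probes I ≤ D * (1 + a * (1 + a * s * s)) := by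
  rw [relaysProc, probes_bind, probes_readNbrs, run_readNbrs]
  have h1 := probes_select_le I
    (fun w => (goodNbrsProc X s w).bind fun S => .done (decide S.Nonempty))
    (nbhd I.graph v ∩ Y) (D * (1 + a * s * s))
    fun x _ => by simpa [probes_bind, probes] using probes_goodNbrsProc_le hD hX x
  have h2 := Nat.mul_le_mul_right (D * (1 + a * s * s)) (hY v)
  have h3 : a * (D * (1 + a * s * s)) = D * (a * (1 + a * s * s)) := by ring
  rw [mul_add]
  linarith [hD v]

theorem probes_parentProc_le (hD : ∀ v, (nbhd I.graph v).card + 1 ≤ D)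
    (hX : ∀ v, (nbhd I.graph v ∩ X).card ≤ a) (hY : ∀ v, (nbhd I.graph v ∩ Y).card ≤ a)
    (v : Fin n) :
    (parentProc X Y s v).probes I ≤ D * (1 + a * s * s) + D * (1 + a * (1 + a * s * s)) := by
  rw [parentProc, probes_bind]
  refine add_le_add (probes_goodNbrsProc_le hD hX v) ?_
  split_ifs
  · simp [probes]
  · simpa [probes_bind, probes] using probes_relaysProc_le hD hX hY v

theorem probes_adjProc_le (hD : ∀ v, (nbhd I.graph v).card + 1 ≤ D)
    (hX : ∀ v, (nbhd I.graph v ∩ X).card ≤ a) (hY : ∀ v, (nbhd I.graph v ∩ Y).card ≤ a)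
    (u v : Fin n) :
    (adjProc X Y s u v).probes I ≤
      D + 2 * (D * (1 + a * s * s) + D * (1 + a * (1 + a * s * s))) := by
  simp only [adjProc, probes_bind, probes_readNbrs, probes]
  linarith [hD u, probes_parentProc_le (s := s) hD hX hY u,
    probes_parentProc_le (s := s) hD hX hY v]

end ProbeTree

/-! ### Independence and tail bounds in the binomial random graph. -/

section Measure

open MeasureTheory

variable {n : ℕ}

theorem measurableSet_of_simpleGraph (T : Set (SimpleGraph (Fin n))) : MeasurableSet T := by
  have : MeasurableSingletonClass (SimpleGraph (Fin n)) := by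
    refine ⟨fun G => ?_⟩
    have h : ({G} : Set (SimpleGraph (Fin n))) =
        ⋂ (u : Fin n) (v : Fin n), {G' | G'.Adj u v = G.Adj u v} := by
      ext G'
      simp only [Set.mem_singleton_iff, Set.mem_iInter, Set.mem_ofPred_eq, SimpleGraph.ext_iff,
        funext_iff]
    rw [h]
    refine MeasurableSet.iInter fun u => MeasurableSet.iInter fun v => ?_
    exact (SimpleGraph.measurable_iff_adj.1 measurable_id u v) (MeasurableSet.of_discrete
      (s := {G.Adj u v}))
  exact (Set.toFinite T).measurableSet

theorem binomialRandom_real_eq_sum (p : unitInterval) (T : Set (SimpleGraph (Fin n)))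
    [DecidablePred (· ∈ T)] :
    (SimpleGraph.binomialRandom (Fin n) p).real T =
      ∑ G : SimpleGraph (Fin n) with G ∈ T,
        (p : ℝ) ^ G.edgeSet.ncard * (1 - p : ℝ) ^ (n.choose 2 - G.edgeSet.ncard) := by
  have : T = ((Finset.univ.filter (· ∈ T) : Finset (SimpleGraph (Fin n))) :
      Set (SimpleGraph (Fin n))) := by ext; simp
  conv_lhs => rw [this]
  have : MeasurableSingletonClass (SimpleGraph (Fin n)) := ⟨fun _ => measurableSet_of_simpleGraph _⟩
  rw [← sum_measureReal_singleton]
  refine Finset.sum_congr rfl fun G _ => ?_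
  simp [measureReal_def]

/-- Membership in `T` is determined by the edges in `P`. -/
def DeterminedBy (P : Set (Sym2 (Fin n))) (T : Set (SimpleGraph (Fin n))) : Prop :=
  ∀ G G' : SimpleGraph (Fin n), (∀ e ∈ P, e ∈ G.edgeSet ↔ e ∈ G'.edgeSet) → (G ∈ T ↔ G' ∈ T)

theorem ncard_edgeSet_le_choose (G : SimpleGraph (Fin n)) : G.edgeSet.ncard ≤ n.choose 2 := by
  classical
  have := G.card_edgeFinset_le_card_choose_two
  rwa [← Set.ncard_coe_finset, SimpleGraph.coe_edgeFinset, Fintype.card_fin] at this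

/-- Toggling `e` does not affect membership in `T`, and it is a bijection between the graphs of `T`
without `e` and those with `e`. It multiplies weights by `p / (1 - p)`, which is `hswap` with
denominators cleared. -/
theorem binomialRandom_real_inter_edge (p : unitInterval) {P : Set (Sym2 (Fin n))}
    {T : Set (SimpleGraph (Fin n))} (hT : DeterminedBy P T) {e : Sym2 (Fin n)}
    (he : ¬ e.IsDiag) (heP : e ∉ P) :
    (SimpleGraph.binomialRandom (Fin n) p).real (T ∩ {G | e ∈ G.edgeSet}) =
      p * (SimpleGraph.binomialRandom (Fin n) p).real T := by
  classical
  set μ := SimpleGraph.binomialRandom (Fin n) p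
  have hswap : (1 - p : ℝ) * μ.real (T ∩ {G | e ∈ G.edgeSet}) =
      p * μ.real (T \ {G | e ∈ G.edgeSet}) := by
    rw [binomialRandom_real_eq_sum, binomialRandom_real_eq_sum, Finset.mul_sum, Finset.mul_sum]
    symm
    have hadd : ∀ G : SimpleGraph (Fin n),
        (G ⊔ SimpleGraph.fromEdgeSet {e}).edgeSet = insert e G.edgeSet := by
      intro G
      have : ({e} : Set (Sym2 (Fin n))) \ Sym2.diagSet = {e} := by
        rw [sdiff_eq_left, Set.disjoint_singleton_left]; simpa using he
      simp only [SimpleGraph.edgeSet_sup, SimpleGraph.edgeSet_fromEdgeSet, this]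
      rw [Set.union_comm, Set.singleton_union]
    have hdel : ∀ G : SimpleGraph (Fin n),
        (G.deleteEdges {e}).edgeSet = G.edgeSet \ {e} := fun G => by simp
    refine Finset.sum_bij' (fun G _ => G ⊔ SimpleGraph.fromEdgeSet {e})
      (fun G _ => G.deleteEdges {e}) ?_ ?_ ?_ ?_ ?_
    · intro G hG
      simp only [Finset.mem_filter, Finset.mem_univ, true_and, Set.mem_sdiff, Set.mem_inter_iff,
        Set.mem_ofPred_eq] at hG ⊢
      refine ⟨(hT _ _ fun e' he' => ?_).1 hG.1, by rw [hadd]; exact Set.mem_insert _ _⟩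
      have : e' ≠ e := fun h => heP (h ▸ he')
      rw [hadd]; simp [this]
    · intro G hG
      simp only [Finset.mem_filter, Finset.mem_univ, true_and, Set.mem_sdiff, Set.mem_inter_iff,
        Set.mem_ofPred_eq] at hG ⊢
      refine ⟨(hT _ _ fun e' he' => ?_).1 hG.1, by rw [hdel]; simp⟩
      have : e' ≠ e := fun h => heP (h ▸ he')
      rw [hdel]; simp [this]
    · intro G hG
      simp only [Finset.mem_filter, Finset.mem_univ, true_and, Set.mem_sdiff,
        Set.mem_ofPred_eq] at hG
      rw [← SimpleGraph.edgeSet_inj, hdel, hadd]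
      ext x
      simp only [Set.mem_sdiff, Set.mem_insert_iff, Set.mem_singleton_iff]
      constructor
      · tauto
      · intro hx
        exact ⟨Or.inr hx, fun h => hG.2 (h ▸ hx)⟩
    · intro G hG
      simp only [Finset.mem_filter, Finset.mem_univ, true_and, Set.mem_inter_iff,
        Set.mem_ofPred_eq] at hG
      rw [← SimpleGraph.edgeSet_inj, hadd, hdel]
      simp [Set.insert_eq_of_mem hG.2]
    · intro G hG
      simp only [Finset.mem_filter, Finset.mem_univ, true_and, Set.mem_sdiff,
        Set.mem_ofPred_eq] at hG
      have hc : (insert e G.edgeSet).ncard = G.edgeSet.ncard + 1 :=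
        Set.ncard_insert_of_notMem hG.2 (Set.toFinite _)
      have hle := ncard_edgeSet_le_choose (G ⊔ SimpleGraph.fromEdgeSet {e})
      rw [hadd, hc] at hle ⊢
      obtain ⟨d, hd⟩ := Nat.exists_eq_add_of_le hle
      rw [hd, show G.edgeSet.ncard + 1 + d - G.edgeSet.ncard = d + 1 by omega,
        show G.edgeSet.ncard + 1 + d - (G.edgeSet.ncard + 1) = d by omega]
      ring
  have hsum := measureReal_inter_add_sdiff (μ := μ) (s := T)
    (measurableSet_of_simpleGraph {G : SimpleGraph (Fin n) | e ∈ G.edgeSet})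
  linear_combination hswap + (p : ℝ) * hsum

/-- All edges in `A` are present and all edges in `B` are absent. -/
def edgePattern (A B : Finset (Sym2 (Fin n))) : Set (SimpleGraph (Fin n)) :=
  {G | (∀ e ∈ A, e ∈ G.edgeSet) ∧ ∀ e ∈ B, e ∉ G.edgeSet}

theorem DeterminedBy.inter_edgePattern {P : Set (Sym2 (Fin n))} {T : Set (SimpleGraph (Fin n))}
    (hT : DeterminedBy P T) (A B : Finset (Sym2 (Fin n))) :
    DeterminedBy (P ∪ A ∪ B) (T ∩ edgePattern A B) := by
  intro G G' h
  have h1 := hT G G' fun e he => h e (Or.inl (Or.inl he))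
  have h2 : ∀ e ∈ A, e ∈ G.edgeSet ↔ e ∈ G'.edgeSet := fun e he => h e (Or.inl (Or.inr he))
  have h3 : ∀ e ∈ B, e ∈ G.edgeSet ↔ e ∈ G'.edgeSet := fun e he => h e (Or.inr he)
  simp only [edgePattern, Set.mem_inter_iff, Set.mem_ofPred_eq, h1]
  refine and_congr_right fun _ => and_congr ?_ ?_
  · exact forall₂_congr h2
  · exact forall₂_congr fun e he => not_congr (h3 e he)

/-- The form in which independence is used: pairs outside `P` remain unexposed after conditioning on
`T`. They are revealed one at a time. -/
theorem binomialRandom_real_inter_edgePattern (p : unitInterval) {P : Set (Sym2 (Fin n))}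
    {T : Set (SimpleGraph (Fin n))} (hT : DeterminedBy P T) (A B : Finset (Sym2 (Fin n)))
    (hA : ∀ e ∈ A, ¬ e.IsDiag ∧ e ∉ P) (hB : ∀ e ∈ B, ¬ e.IsDiag ∧ e ∉ P) (hAB : Disjoint A B) :
    (SimpleGraph.binomialRandom (Fin n) p).real (T ∩ edgePattern A B) =
      (SimpleGraph.binomialRandom (Fin n) p).real T * ((p : ℝ) ^ A.card * (1 - p : ℝ) ^ B.card) := by
  classical
  set μ := SimpleGraph.binomialRandom (Fin n) p
  induction B using Finset.induction_on with
  | empty =>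
    induction A using Finset.induction_on with
    | empty => simp [edgePattern]
    | insert e A heA ih =>
      have : T ∩ edgePattern (insert e A) ∅ = (T ∩ edgePattern A ∅) ∩ {G | e ∈ G.edgeSet} := by
        ext G; simp [edgePattern]; tauto
      have h1 := hA e (by simp)
      rw [this, binomialRandom_real_inter_edge p (hT.inter_edgePattern A ∅) h1.1
        (by simp [h1.2, heA]), ih (fun e' he' => hA e' (by simp [he'])) (by simp),
        Finset.card_insert_of_notMem heA]
      ring
  | insert e B heB ih =>
    have h1 := hB e (by simp)
    rw [Finset.disjoint_insert_right] at hAB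
    have : T ∩ edgePattern A (insert e B) = (T ∩ edgePattern A B) \ {G | e ∈ G.edgeSet} := by
      ext G; simp [edgePattern]; tauto
    have hsum := measureReal_inter_add_sdiff (μ := μ) (s := T ∩ edgePattern A B)
      (measurableSet_of_simpleGraph {G : SimpleGraph (Fin n) | e ∈ G.edgeSet})
    rw [binomialRandom_real_inter_edge p (hT.inter_edgePattern A B) h1.1
        (by simp [h1.2, heB, hAB.1]), ih (fun e' he' => hB e' (by simp [he'])) hAB.2] at hsum
    rw [this, Finset.card_insert_of_notMem heB]
    linear_combination hsum

theorem binomialRandom_real_edgePattern (p : unitInterval) (A B : Finset (Sym2 (Fin n)))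
    (hA : ∀ e ∈ A, ¬ e.IsDiag) (hB : ∀ e ∈ B, ¬ e.IsDiag) (hAB : Disjoint A B) :
    (SimpleGraph.binomialRandom (Fin n) p).real (edgePattern A B) =
      (p : ℝ) ^ A.card * (1 - p : ℝ) ^ B.card := by
  have := binomialRandom_real_inter_edgePattern p (P := ∅) (T := Set.univ)
    (fun _ _ _ => by simp) A B (by simpa using hA) (by simpa using hB) hAB
  simpa using this

/-- This is the usual `(eN / M) ^ M` bound on the binomial coefficient, without division so that `M
= 0` is covered. -/
theorem choose_le_exp_mul_div_pow (N M : ℕ) :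
    (N.choose M : ℝ) * (M : ℝ) ^ M ≤ (Real.exp 1 * N) ^ M := by
  have h1 : (N.choose M : ℝ) ≤ (N : ℝ) ^ M / M.factorial := Nat.choose_le_pow_div M N
  have h2 : (M : ℝ) ^ M / M.factorial ≤ Real.exp M :=
    Real.pow_div_factorial_le_exp (M : ℝ) (by positivity) M
  calc (N.choose M : ℝ) * (M : ℝ) ^ M ≤ (N : ℝ) ^ M / M.factorial * (M : ℝ) ^ M := by gcongr
    _ = (M : ℝ) ^ M / M.factorial * (N : ℝ) ^ M := by ring
    _ ≤ Real.exp M * (N : ℝ) ^ M := by gcongr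
    _ = (Real.exp 1 * N) ^ M := by rw [mul_pow, ← Real.exp_nat_mul, mul_one]

-- Union bound over the `M`-subsets of `P` that are entirely present.
open Classical in
theorem binomialRandom_real_card_ge_le (p : unitInterval) (P : Finset (Sym2 (Fin n)))
    (hP : ∀ e ∈ P, ¬ e.IsDiag) (M : ℕ) :
    (SimpleGraph.binomialRandom (Fin n) p).real
      {G | M ≤ (P.filter (· ∈ G.edgeSet)).card} ≤ P.card.choose M * (p : ℝ) ^ M := by
  have hsub : {G : SimpleGraph (Fin n) | M ≤ (P.filter (· ∈ G.edgeSet)).card} ⊆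
      ⋃ A ∈ P.powersetCard M, edgePattern A ∅ := by
    intro G hG
    obtain ⟨A, hA, hAM⟩ := Finset.exists_subset_card_eq hG
    simp only [Set.mem_iUnion]
    refine ⟨A, Finset.mem_powersetCard.2 ⟨hA.trans (Finset.filter_subset _ _), hAM⟩, ?_, by simp⟩
    exact fun e he => (Finset.mem_filter.1 (hA he)).2
  refine (measureReal_mono hsub (measure_ne_top _ _)).trans ((measureReal_biUnion_finset_le _ _).trans ?_)
  rw [← Finset.card_powersetCard, ← nsmul_eq_mul, ← Finset.sum_const]
  refine Finset.sum_le_sum fun A hA => ?_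
  rw [Finset.mem_powersetCard] at hA
  rw [binomialRandom_real_edgePattern p A ∅ (fun e he => hP e (hA.1 he)) (by simp) (by simp), hA.2]
  simp

open Classical in
/-- A binomial variable exceeds `M`, at least `e²` times its mean, with probability at most
`exp (-M)`. -/
theorem binomialRandom_real_card_ge_le_exp (p : unitInterval) (P : Finset (Sym2 (Fin n)))
    (hP : ∀ e ∈ P, ¬ e.IsDiag) (M : ℕ) (hM : Real.exp 2 * (P.card * p) ≤ M) :
    (SimpleGraph.binomialRandom (Fin n) p).real
      {G | M ≤ (P.filter (· ∈ G.edgeSet)).card} ≤ Real.exp (-M) := by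
  rcases Nat.eq_zero_or_pos M with rfl | hM0
  · simp
  refine (binomialRandom_real_card_ge_le p P hP M).trans ?_
  have hp := p.2.1
  have hM0' : (0 : ℝ) < (M : ℝ) ^ M := by positivity
  rw [← mul_le_mul_iff_left₀ hM0']
  calc P.card.choose M * (p : ℝ) ^ M * (M : ℝ) ^ M
      = (P.card.choose M * (M : ℝ) ^ M) * (p : ℝ) ^ M := by ring
    _ ≤ (Real.exp 1 * P.card) ^ M * (p : ℝ) ^ M := by
        gcongr; exact choose_le_exp_mul_div_pow _ _
    _ = (Real.exp (-1) * (Real.exp 2 * (P.card * p))) ^ M := by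
        rw [← mul_pow, ← mul_assoc (Real.exp (-1)), ← Real.exp_add]; norm_num [mul_assoc]
    _ ≤ (Real.exp (-1) * M) ^ M := by gcongr
    _ = Real.exp (-M) * (M : ℝ) ^ M := by
        rw [mul_pow, ← Real.exp_nat_mul]; simp

end Measure

/-! ### Probabilities of the structural bad events. -/

section Events

open MeasureTheory

variable {n : ℕ}

theorem one_sub_pow_le_exp (p : unitInterval) (k : ℕ) :
    (1 - p : ℝ) ^ k ≤ Real.exp (-(p * k)) := by
  have h := Real.one_sub_le_exp_neg (p : ℝ)
  have h0 : (0 : ℝ) ≤ 1 - p := by linarith [p.2.2]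
  calc (1 - p : ℝ) ^ k ≤ Real.exp (-p) ^ k := by gcongr
    _ = Real.exp (-(p * k)) := by rw [← Real.exp_nat_mul]; ring_nf

/-- The pairs with one element in `S` and the other in `T`. -/
def crossPairs (S T : Finset (Fin n)) : Finset (Sym2 (Fin n)) :=
  (S ×ˢ T).image fun q => s(q.1, q.2)

theorem mem_crossPairs {S T : Finset (Fin n)} {e : Sym2 (Fin n)} :
    e ∈ crossPairs S T ↔ ∃ x ∈ S, ∃ y ∈ T, s(x, y) = e := by
  simp [crossPairs, and_assoc]

theorem card_crossPairs {S T : Finset (Fin n)} (h : Disjoint S T) :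
    (crossPairs S T).card = S.card * T.card := by
  rw [crossPairs, Finset.card_image_of_injOn, Finset.card_product]
  rintro ⟨a, b⟩ hab ⟨c, d⟩ hcd he
  simp only [Finset.coe_product, Set.mem_prod, Finset.mem_coe] at hab hcd
  rcases Sym2.eq_iff.1 he with ⟨h1, h2⟩ | ⟨h1, h2⟩
  · exact Prod.ext h1 h2
  · exact absurd hcd.2 (Finset.disjoint_left.1 h (by simpa [← show a = d from h1] using hab.1))

theorem not_isDiag_of_mem_crossPairs {S T : Finset (Fin n)} (h : Disjoint S T)
    {e : Sym2 (Fin n)} (he : e ∈ crossPairs S T) : ¬ e.IsDiag := by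
  obtain ⟨x, hx, y, hy, rfl⟩ := mem_crossPairs.1 he
  rw [Sym2.mk_isDiag_iff]
  rintro rfl
  exact Finset.disjoint_left.1 h hx hy

theorem ClosedIn.notMem_edgeSet {G : SimpleGraph (Fin n)} {X S : Finset (Fin n)}
    (h : ClosedIn G X S) : ∀ e ∈ crossPairs S (X \ S), e ∉ G.edgeSet := by
  intro e he hG
  obtain ⟨x, hx, y, hy, rfl⟩ := mem_crossPairs.1 he
  rw [Finset.mem_sdiff] at hy
  exact hy.2 (h.2 x hx y hy.1 hG)

/-- Union bound over at most `2 ^ |X|` sets `S`; each forces at least `|X| / 4 · |X| / 2` absent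
pairs. -/
theorem binomialRandom_real_not_noBalancedCut_le (p : unitInterval) (X : Finset (Fin n)) :
    (SimpleGraph.binomialRandom (Fin n) p).real {G | ¬ NoBalancedCut G X} ≤
      2 ^ X.card * Real.exp (-(p * X.card ^ 2 / 8)) := by
  classical
  have hsub : {G : SimpleGraph (Fin n) | ¬ NoBalancedCut G X} ⊆
      ⋃ S ∈ X.powerset.filter (fun S => X.card ≤ 4 * S.card ∧ 2 * S.card ≤ X.card),
        edgePattern ∅ (crossPairs S (X \ S)) := by
    intro G hG
    simp only [NoBalancedCut, Set.mem_ofPred_eq, not_forall, not_lt] at hG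
    obtain ⟨S, hS, h4, h2⟩ := hG
    simp only [Set.mem_iUnion]
    exact ⟨S, by simp [hS.1, h4, h2], by simp, hS.notMem_edgeSet⟩
  refine (measureReal_mono hsub (measure_ne_top _ _)).trans
    ((measureReal_biUnion_finset_le _ _).trans ?_)
  calc _ ≤ ∑ S ∈ X.powerset.filter (fun S => X.card ≤ 4 * S.card ∧ 2 * S.card ≤ X.card),
        Real.exp (-(p * X.card ^ 2 / 8)) := by
        refine Finset.sum_le_sum fun S hS => ?_
        simp only [Finset.mem_filter, Finset.mem_powerset] at hS
        obtain ⟨hSX, h4, h2⟩ := hS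
        rw [binomialRandom_real_edgePattern p _ _ (by simp)
          (fun e he => not_isDiag_of_mem_crossPairs Finset.disjoint_sdiff he) (by simp),
          card_crossPairs Finset.disjoint_sdiff, Finset.card_sdiff_of_subset hSX,
          Finset.card_empty, pow_zero, one_mul]
        refine (one_sub_pow_le_exp p _).trans (Real.exp_le_exp.2 (neg_le_neg ?_))
        rw [mul_div_assoc]
        refine mul_le_mul_of_nonneg_left ?_ p.2.1
        push_cast [Nat.cast_sub (Finset.card_le_card hSX)]
        have h4' : (X.card : ℝ) ≤ 4 * S.card := mod_cast h4
        have h2' : 2 * (S.card : ℝ) ≤ X.card := mod_cast h2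
        nlinarith
    _ = ((X.powerset.filter (fun S => X.card ≤ 4 * S.card ∧ 2 * S.card ≤ X.card)).card : ℝ) *
        Real.exp (-(p * X.card ^ 2 / 8)) := by rw [Finset.sum_const, nsmul_eq_mul]
    _ ≤ _ := by
        gcongr
        exact_mod_cast (Finset.card_filter_le _ _).trans_eq (Finset.card_powerset X)

open Classical in
/-- The edges from the vertices to their images under a self-map of `S`. -/
noncomputable def mapEdges {S : Finset (Fin n)} (f : S → S) : Finset (Sym2 (Fin n)) :=
  (Finset.univ.image fun v : S => s((v : Fin n), (f v : Fin n))).filter fun e => ¬ e.IsDiag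

/-- A breadth-first tree is encoded by pointers toward the root `x`. Counting self-maps, `|S| ^ |S|`
of them, replaces Cayley's formula; the root points to itself and its loop is discarded. -/
theorem exists_spanning_map {G : SimpleGraph (Fin n)} {X : Finset (Fin n)} {x : Fin n}
    (hx : x ∈ X) : ∃ f : compIn G X x → compIn G X x,
      (compIn G X x).card ≤ (mapEdges f).card + 1 ∧ ∀ e ∈ mapEdges f, e ∈ G.edgeSet := by
  classical
  have step : ∀ v : compIn G X x, (v : Fin n) ≠ x → ∃ z : compIn G X x,
      G.Adj v z ∧ (within G X).dist z x < (within G X).dist v x := by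
    rintro ⟨v, hv⟩ hvx
    have hr := (mem_compIn.1 hv).symm
    obtain ⟨w, hw⟩ := hr.exists_walk_length_eq_dist
    cases w with
    | nil => exact absurd rfl hvx
    | cons h q =>
      rename_i z
      refine ⟨⟨z, (closedIn_compIn hx).2 v hv z h.2.2 h.1⟩, h.1, ?_⟩
      have := (within G X).dist_le q
      rw [SimpleGraph.Walk.length_cons] at hw
      simp only
      omega
  choose g hg using step
  let r : compIn G X x := ⟨x, mem_compIn.2 (SimpleGraph.Reachable.refl _)⟩
  let f : compIn G X x → compIn G X x := fun v => if h : (v : Fin n) = x then r else g v h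
  have hf : ∀ v : compIn G X x, ∀ h : (v : Fin n) ≠ x, f v = g v h := fun v h => by simp [f, h]
  have hfr : f r = r := by simp [f, r]
  refine ⟨f, ?_, ?_⟩
  · have hsub : ((Finset.univ : Finset (compIn G X x)).erase r).image
        (fun v : compIn G X x => s((v : Fin n), (f v : Fin n))) ⊆ mapEdges f := by
      intro e he
      simp only [Finset.mem_image, Finset.mem_erase, Finset.mem_univ, and_true] at he
      obtain ⟨v, hv, rfl⟩ := he
      have hvx : (v : Fin n) ≠ x := fun h => hv (Subtype.ext h)
      simp only [mapEdges, Finset.mem_filter, Finset.mem_image, Finset.mem_univ, true_and,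
        exists_apply_eq_apply, Sym2.mk_isDiag_iff]
      rw [hf v hvx]
      exact (hg v hvx).1.ne
    have hcard := Finset.card_le_card hsub
    rw [Finset.card_image_of_injOn, Finset.card_erase_of_mem (Finset.mem_univ _),
      Finset.card_univ, Fintype.card_coe] at hcard
    · omega
    · intro u hu v hv huv
      simp only [Finset.coe_erase, Finset.coe_univ, Set.mem_sdiff, Set.mem_univ, true_and,
        Set.mem_singleton_iff] at hu hv
      have hux : (u : Fin n) ≠ x := fun h => hu (Subtype.ext h)
      have hvx : (v : Fin n) ≠ x := fun h => hv (Subtype.ext h)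
      -- In the second case `u` and `v` point to each other, but the distance to `x` strictly
      -- decreases along pointers.
      rcases Sym2.eq_iff.1 huv with ⟨h1, -⟩ | ⟨h1, h2⟩
      · exact Subtype.ext h1
      · have hu' := (hg u hux).2
        have hv' := (hg v hvx).2
        rw [← hf u hux, h2] at hu'
        rw [← hf v hvx, ← h1] at hv'
        omega
  · intro e he
    simp only [mapEdges, Finset.mem_filter, Finset.mem_image, Finset.mem_univ, true_and] at he
    obtain ⟨⟨v, rfl⟩, hd⟩ := he
    by_cases hvx : (v : Fin n) = x
    · have : v = r := Subtype.ext hvx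
      subst this
      rw [hfr] at hd
      exact absurd (Sym2.mk_isDiag_iff.2 rfl) hd
    · rw [hf v hvx]
      exact (hg v hvx).1

/-- A medium component on `S` has a spanning tree present and all pairs between `S` and `X \ S`
absent; these are disjoint sets of pairs. -/
theorem binomialRandom_real_not_noMediumComponent_le_sum (p : unitInterval) (X : Finset (Fin n))
    (s : ℕ) :
    (SimpleGraph.binomialRandom (Fin n) p).real {G | ¬ NoMediumComponent G X s} ≤
      ∑ S ∈ X.powerset, if s ≤ S.card ∧ 2 * S.card ≤ X.card then
        (S.card : ℝ) ^ S.card *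
          ((p : ℝ) ^ (S.card - 1) * (1 - p : ℝ) ^ (S.card * (X.card - S.card))) else 0 := by
  classical
  rw [← Finset.sum_filter]
  have hsub : {G : SimpleGraph (Fin n) | ¬ NoMediumComponent G X s} ⊆
      ⋃ S ∈ X.powerset.filter (fun S => s ≤ S.card ∧ 2 * S.card ≤ X.card),
        ⋃ f ∈ (Finset.univ : Finset (S → S)).filter (fun f => S.card ≤ (mapEdges f).card + 1),
          edgePattern (mapEdges f) (crossPairs S (X \ S)) := by
    intro G hG
    simp only [NoMediumComponent, Set.mem_ofPred_eq, not_forall, not_lt] at hG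
    obtain ⟨x, hx, hs, h2⟩ := hG
    obtain ⟨f, hf, hfG⟩ := exists_spanning_map (G := G) hx
    simp only [Set.mem_iUnion]
    exact ⟨compIn G X x, by simp [compIn_subset hx, hs, h2], f, by simp [hf], hfG,
      (closedIn_compIn hx).notMem_edgeSet⟩
  refine (measureReal_mono hsub (measure_ne_top _ _)).trans
    ((measureReal_biUnion_finset_le _ _).trans (Finset.sum_le_sum fun S hS => ?_))
  simp only [Finset.mem_filter, Finset.mem_powerset] at hS
  refine (measureReal_biUnion_finset_le _ _).trans ?_
  have hp0 := p.2.1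
  have hp1 := p.2.2
  have h0 : (0 : ℝ) ≤ 1 - p := by linarith
  calc _ ≤ ∑ f ∈ (Finset.univ : Finset (S → S)).filter (fun f => S.card ≤ (mapEdges f).card + 1),
        ((p : ℝ) ^ (S.card - 1) * (1 - p : ℝ) ^ (S.card * (X.card - S.card))) := by
        refine Finset.sum_le_sum fun f hf => ?_
        simp only [Finset.mem_filter, Finset.mem_univ, true_and] at hf
        rw [binomialRandom_real_edgePattern p _ _
          (fun e (he : e ∈ mapEdges f) => (Finset.mem_filter.1 he).2)
          (fun e he => not_isDiag_of_mem_crossPairs Finset.disjoint_sdiff he),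
          card_crossPairs Finset.disjoint_sdiff, Finset.card_sdiff_of_subset hS.1]
        · gcongr ?_ * _
          exact pow_le_pow_of_le_one hp0 hp1 (by omega)
        · rw [Finset.disjoint_left]
          intro e he he'
          simp only [mapEdges, Finset.mem_filter, Finset.mem_image, Finset.mem_univ,
            true_and] at he
          obtain ⟨⟨v, rfl⟩, -⟩ := he
          obtain ⟨a, ha, b, hb, hab⟩ := mem_crossPairs.1 he'
          rw [Finset.mem_sdiff] at hb
          rcases Sym2.eq_iff.1 hab with ⟨-, h⟩ | ⟨-, h⟩
          · exact hb.2 (h ▸ (f v).2)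
          · exact hb.2 (h ▸ v.2)
    _ ≤ ∑ f : S → S,
        ((p : ℝ) ^ (S.card - 1) * (1 - p : ℝ) ^ (S.card * (X.card - S.card))) :=
        Finset.sum_le_sum_of_subset_of_nonneg (Finset.filter_subset _ _)
          fun _ _ _ => by positivity
    _ = _ := by
        rw [Finset.sum_const, nsmul_eq_mul, Finset.card_univ, Fintype.card_fun, Fintype.card_coe]
        push_cast
        rfl

theorem mul_exp_half_le {K : ℝ} (hK : 48 ≤ K) :
    Real.exp 1 * K * Real.exp (-(K / 2)) ≤ Real.exp (-5) := by
  have h1 : K ≤ Real.exp (K / 4) := by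
    -- Squaring gives `exp (K / 4) ≥ (1 + K / 8)²`, which is at least `K` once `K ≥ 48`.
    have h := Real.add_one_le_exp (K / 8)
    have h2 : Real.exp (K / 4) = Real.exp (K / 8) * Real.exp (K / 8) := by
      rw [← Real.exp_add]; ring_nf
    nlinarith
  calc Real.exp 1 * K * Real.exp (-(K / 2))
      ≤ Real.exp 1 * Real.exp (K / 4) * Real.exp (-(K / 2)) := by gcongr
    _ = Real.exp (1 - K / 4) := by rw [← Real.exp_add, ← Real.exp_add]; ring_nf
    _ ≤ Real.exp (-5) := Real.exp_le_exp.2 (by linarith)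

/-- With `K = p |X|`, sets of size `j` contribute at most `(e K exp (-K / 2)) ^ j / p`. The factor
`p` on the left completes the tree's `p ^ (j - 1)` to `p ^ j`. -/
theorem binomialRandom_real_not_noMediumComponent_le (p : unitInterval) (X : Finset (Fin n))
    {s : ℕ} (hs : 0 < s) (hK : 48 ≤ (p : ℝ) * X.card) :
    (p : ℝ) * (SimpleGraph.binomialRandom (Fin n) p).real {G | ¬ NoMediumComponent G X s} ≤
      (X.card + 1) * Real.exp (-(5 * s)) := by
  classical
  have hp0 := p.2.1
  have hp1 := p.2.2
  have h0 : (0 : ℝ) ≤ 1 - p := by linarith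
  have h := binomialRandom_real_not_noMediumComponent_le_sum p X s
  rw [Finset.sum_powerset_apply_card (fun j => if s ≤ j ∧ 2 * j ≤ X.card then
        (j : ℝ) ^ j * ((p : ℝ) ^ (j - 1) * (1 - p : ℝ) ^ (j * (X.card - j))) else 0)] at h
  refine (mul_le_mul_of_nonneg_left h hp0).trans ?_
  rw [Finset.mul_sum]
  have hterm : ∀ j ∈ Finset.range (X.card + 1),
      (p : ℝ) * (X.card.choose j • if s ≤ j ∧ 2 * j ≤ X.card then
        (j : ℝ) ^ j * ((p : ℝ) ^ (j - 1) * (1 - p : ℝ) ^ (j * (X.card - j))) else 0) ≤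
      Real.exp (-(5 * s)) := by
    intro j _
    split_ifs with hj
    · have hjp : (p : ℝ) * (p : ℝ) ^ (j - 1) = (p : ℝ) ^ j := by
        rw [← pow_succ']; congr 1; omega
      have hexp : (1 - p : ℝ) ^ (j * (X.card - j)) ≤ Real.exp (-(p * X.card / 2)) ^ j := by
        refine (one_sub_pow_le_exp p _).trans ?_
        rw [← Real.exp_nat_mul, Real.exp_le_exp]
        push_cast [Nat.cast_sub (show j ≤ X.card by omega)]
        have h2 : 2 * (j : ℝ) ≤ X.card := mod_cast hj.2
        nlinarith [mul_nonneg hp0 (Nat.cast_nonneg (α := ℝ) j)]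
      calc _ = (X.card.choose j * (j : ℝ) ^ j) * ((p : ℝ) * (p : ℝ) ^ (j - 1)) *
            (1 - p : ℝ) ^ (j * (X.card - j)) := by rw [nsmul_eq_mul]; ring
        _ ≤ (Real.exp 1 * X.card) ^ j * (p : ℝ) ^ j * Real.exp (-(p * X.card / 2)) ^ j := by
            rw [hjp]
            gcongr
            exact choose_le_exp_mul_div_pow _ _
        _ = (Real.exp 1 * (p * X.card) * Real.exp (-(p * X.card / 2))) ^ j := by
            rw [← mul_pow, ← mul_pow]; ring_nf
        _ ≤ Real.exp (-5) ^ j := by gcongr; exact mul_exp_half_le hK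
        _ = Real.exp (-(5 * j)) := by rw [← Real.exp_nat_mul]; ring_nf
        _ ≤ Real.exp (-(5 * s)) := by
            have : (s : ℝ) ≤ j := mod_cast hj.1
            exact Real.exp_le_exp.2 (by linarith)
    · simp; positivity
  refine (Finset.sum_le_sum hterm).trans ?_
  simp

theorem searchBall_congr {G G' : SimpleGraph (Fin n)} {X : Finset (Fin n)} (s : ℕ)
    (h : ∀ e ∈ X.sym2, e ∈ G.edgeSet ↔ e ∈ G'.edgeSet) {x : Fin n} (hx : x ∈ X) (i : ℕ) :
    searchBall G X s x i = searchBall G' X s x i := by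
  induction i with
  | zero => rfl
  | succ i ih =>
    have hsub := (searchBall_subset_compIn (G := G') (s := s) hx i).trans (compIn_subset hx)
    rw [searchBall, searchBall, ih]
    generalize searchBall G' X s x i = A at hsub
    unfold grow
    have : A.biUnion (nbhd G) ∩ X = A.biUnion (nbhd G') ∩ X := by
      ext y
      simp only [Finset.mem_inter, Finset.mem_biUnion, mem_nbhd]
      refine and_congr_left fun hy => exists_congr fun z => and_congr_right fun hz => ?_
      exact h s(z, y) (Finset.mk_mem_sym2_iff.2 ⟨hsub hz, hy⟩)
    rw [this]

/-- The search never leaves `X`, so exposing the good set reveals only pairs inside `X`. -/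
theorem determinedBy_goods (X : Finset (Fin n)) (s : ℕ) (g : Finset (Fin n)) :
    DeterminedBy (X.sym2 : Set (Sym2 (Fin n))) {G | goods G X s = g} := by
  intro G G' h
  have : goods G X s = goods G' X s := by
    ext x
    simp only [goods, Finset.mem_filter, IsGood]
    exact and_congr_right fun hx => by rw [searchBall_congr s h hx]
  simp [this]

/-- Given the good set `g`, each `w ∈ Y` fails independently: either `vw` is absent, or it is
present and `w` has no neighbour in `g`. Removing `v` from `g` and from `Y` avoids using a pair `vw`
twice and avoids loops. Summing over the neighbours `D` of `v` in `Y` gives the power by the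
binomial theorem. -/
theorem binomialRandom_real_goods_eq_relays_empty_le (p : unitInterval) {X Y : Finset (Fin n)}
    (hXY : Disjoint X Y) (s : ℕ) (v : Fin n) (g : Finset (Fin n)) (hg : g ⊆ X) :
    (SimpleGraph.binomialRandom (Fin n) p).real
        {G | goods G X s = g ∧ ¬ (relays G X Y s v).Nonempty} ≤
      (SimpleGraph.binomialRandom (Fin n) p).real {G | goods G X s = g} *
        (p * (1 - p : ℝ) ^ (g.erase v).card + (1 - p)) ^ (Y.erase v).card := by
  classical
  have hsub : {G : SimpleGraph (Fin n) | goods G X s = g ∧ ¬ (relays G X Y s v).Nonempty} ⊆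
      ⋃ D ∈ (Y.erase v).powerset, {G | goods G X s = g} ∩
        edgePattern (crossPairs {v} D)
          (crossPairs {v} (Y.erase v \ D) ∪ crossPairs D (g.erase v)) := by
    rintro G ⟨hG, hr⟩
    simp only [Set.mem_iUnion]
    refine ⟨(Y.erase v).filter (G.Adj v), by simp, hG, ?_, ?_⟩
    · intro e he
      obtain ⟨a, ha, w, hw, rfl⟩ := mem_crossPairs.1 he
      rw [Finset.mem_singleton.1 ha]
      exact (Finset.mem_filter.1 hw).2
    · intro e he hGe
      rcases Finset.mem_union.1 he with he | he
      · obtain ⟨a, ha, w, hw, rfl⟩ := mem_crossPairs.1 he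
        rw [Finset.mem_singleton.1 ha] at hGe
        simp only [Finset.mem_sdiff, Finset.mem_filter, not_and] at hw
        exact hw.2 hw.1 hGe
      · obtain ⟨w, hw, x, hx, rfl⟩ := mem_crossPairs.1 he
        simp only [Finset.mem_filter, Finset.mem_erase] at hw hx
        refine hr ⟨w, ?_⟩
        simp only [relays, Finset.mem_filter, Finset.mem_inter, mem_nbhd]
        exact ⟨⟨hw.2, hw.1.2⟩, x, by simp [goodNbrs, hG, hx.2]; exact hGe⟩
  refine (measureReal_mono hsub (measure_ne_top _ _)).trans
    ((measureReal_biUnion_finset_le _ _).trans ?_)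
  rw [← Finset.sum_pow_mul_eq_add_pow, Finset.mul_sum]
  refine Finset.sum_le_sum fun D hD => ?_
  rw [Finset.mem_powerset] at hD
  have hDv : ∀ w ∈ Y.erase v, w ≠ v ∧ w ∈ Y ∧ w ∉ X := fun w hw => by
    rw [Finset.mem_erase] at hw
    exact ⟨hw.1, hw.2, Finset.disjoint_right.1 hXY hw.2⟩
  have hv1 : Disjoint {v} D := by
    rw [Finset.disjoint_singleton_left]; exact fun h => (hDv v (hD h)).1 rfl
  have hv2 : Disjoint {v} (Y.erase v \ D) := by simp
  have hDg : Disjoint D (g.erase v) := by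
    rw [Finset.disjoint_left]
    exact fun w hw hw' => (hDv w (hD hw)).2.2 (hg (Finset.mem_of_mem_erase hw'))
  have hdisj : Disjoint (crossPairs {v} (Y.erase v \ D)) (crossPairs D (g.erase v)) := by
    rw [Finset.disjoint_left]
    intro e he he'
    obtain ⟨a, ha, w, hw, rfl⟩ := mem_crossPairs.1 he
    obtain ⟨w', hw', x, hx, hab⟩ := mem_crossPairs.1 he'
    rw [Finset.mem_singleton] at ha
    subst ha
    rw [Finset.mem_erase] at hx
    rcases Sym2.eq_iff.1 hab with ⟨-, h⟩ | ⟨-, h⟩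
    · exact (hDv w (Finset.mem_sdiff.1 hw).1).2.2 (h ▸ hg hx.2)
    · exact hx.1 h
  rw [binomialRandom_real_inter_edgePattern p (determinedBy_goods X s g)]
  · refine le_of_eq ?_
    rw [Finset.card_union_of_disjoint hdisj, card_crossPairs hv1, card_crossPairs hv2,
      card_crossPairs hDg, Finset.card_sdiff_of_subset hD]
    simp only [Finset.card_singleton, one_mul, pow_add, pow_mul, mul_pow]
    rw [← pow_mul, ← pow_mul, mul_comm D.card (g.erase v).card]
    ring
  · intro e he
    refine ⟨not_isDiag_of_mem_crossPairs hv1 he, ?_⟩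
    obtain ⟨a, -, w, hw, rfl⟩ := mem_crossPairs.1 he
    simp only [Finset.mem_coe, Finset.mk_mem_sym2_iff, not_and]
    exact fun _ => (hDv w (hD hw)).2.2
  · intro e he
    rcases Finset.mem_union.1 he with he | he
    · refine ⟨not_isDiag_of_mem_crossPairs hv2 he, ?_⟩
      obtain ⟨a, -, w, hw, rfl⟩ := mem_crossPairs.1 he
      simp only [Finset.mem_coe, Finset.mk_mem_sym2_iff, not_and]
      exact fun _ => (hDv w (Finset.mem_sdiff.1 hw).1).2.2
    · refine ⟨not_isDiag_of_mem_crossPairs hDg he, ?_⟩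
      obtain ⟨w, hw, x, -, rfl⟩ := mem_crossPairs.1 he
      simp only [Finset.mem_coe, Finset.mk_mem_sym2_iff, not_and]
      exact fun h => absurd h (hDv w (hD hw)).2.2
  · rw [Finset.disjoint_left]
    intro e he he'
    obtain ⟨a, ha, w, hw, rfl⟩ := mem_crossPairs.1 he
    rw [Finset.mem_singleton] at ha
    subst ha
    rcases Finset.mem_union.1 he' with he' | he'
    · obtain ⟨a', ha', w', hw', hab⟩ := mem_crossPairs.1 he'
      rw [Finset.mem_singleton] at ha'
      subst ha'
      rw [Finset.mem_sdiff] at hw'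
      rcases Sym2.eq_iff.1 hab with ⟨-, h⟩ | ⟨h, -⟩
      · exact hw'.2 (h ▸ hw)
      · exact (hDv w (hD hw)).1 h.symm
    · obtain ⟨w', hw', x, hx, hab⟩ := mem_crossPairs.1 he'
      rw [Finset.mem_erase] at hx
      rcases Sym2.eq_iff.1 hab with ⟨-, h⟩ | ⟨-, h⟩
      · exact (hDv w (hD hw)).2.2 (h ▸ hg hx.2)
      · exact hx.1 h

/-- As `exp 23 ≥ 24`, one candidate fails with probability at most `1 - 23 p / 24`, and `(23 / 24)
(5 L - 1) ≥ 4 L`. -/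
theorem relay_failure_le {p : unitInterval} {j y : ℕ} {L : ℝ} (hL : 2 ≤ L)
    (hj : 23 ≤ (p : ℝ) * j) (hy : 5 * L - 1 ≤ p * y) :
    (p * (1 - p : ℝ) ^ j + (1 - p)) ^ y ≤ Real.exp (-(4 * L)) := by
  have hp0 := p.2.1
  have h0 : (0 : ℝ) ≤ 1 - p := by linarith [p.2.2]
  have hq : (1 - p : ℝ) ^ j ≤ 1 / 24 := by
    refine (one_sub_pow_le_exp p j).trans ?_
    rw [Real.exp_neg, inv_eq_one_div]
    have := Real.add_one_le_exp ((p : ℝ) * j)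
    gcongr
    linarith
  calc (p * (1 - p : ℝ) ^ j + (1 - p)) ^ y ≤ Real.exp (-(23 / 24 * p)) ^ y := by
        gcongr
        have := Real.one_sub_le_exp_neg (23 / 24 * (p : ℝ))
        nlinarith
    _ = Real.exp (-(23 / 24 * (p * y))) := by rw [← Real.exp_nat_mul]; ring_nf
    _ ≤ Real.exp (-(4 * L)) := Real.exp_le_exp.2 (by linarith)

theorem binomialRandom_real_relays_empty_le (p : unitInterval) {X Y : Finset (Fin n)}
    (hXY : Disjoint X Y) (s : ℕ) (v : Fin n) {L : ℝ} (hL : 2 ≤ L)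
    (hX : 48 ≤ (p : ℝ) * X.card) (hY : 5 * L ≤ p * Y.card) :
    (SimpleGraph.binomialRandom (Fin n) p).real
        {G | X.card ≤ 2 * (goods G X s).card ∧ ¬ (relays G X Y s v).Nonempty} ≤
      Real.exp (-(4 * L)) := by
  classical
  set μ := SimpleGraph.binomialRandom (Fin n) p
  have hp0 := p.2.1
  have hp1 := p.2.2
  have hsub : {G : SimpleGraph (Fin n) |
        X.card ≤ 2 * (goods G X s).card ∧ ¬ (relays G X Y s v).Nonempty} ⊆
      ⋃ g ∈ X.powerset.filter (fun g => X.card ≤ 2 * g.card),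
        {G | goods G X s = g ∧ ¬ (relays G X Y s v).Nonempty} := by
    rintro G ⟨hG, hr⟩
    simp only [Set.mem_iUnion]
    exact ⟨goods G X s,
      Finset.mem_filter.2 ⟨Finset.mem_powerset.2 (Finset.filter_subset _ _), hG⟩, rfl, hr⟩
  refine (measureReal_mono hsub (measure_ne_top _ _)).trans
    ((measureReal_biUnion_finset_le _ _).trans ?_)
  calc _ ≤ ∑ g ∈ X.powerset.filter (fun g => X.card ≤ 2 * g.card),
        μ.real {G | goods G X s = g} * Real.exp (-(4 * L)) := by
        refine Finset.sum_le_sum fun g hg => ?_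
        simp only [Finset.mem_filter, Finset.mem_powerset] at hg
        refine (binomialRandom_real_goods_eq_relays_empty_le p hXY s v g hg.1).trans ?_
        -- Half of `p |X| ≥ 48` is 24; discarding `v` costs at most `p ≤ 1`, both here and in `Y`.
        refine mul_le_mul_of_nonneg_left (relay_failure_le hL ?_ ?_) measureReal_nonneg
        · have h1 : (g.card : ℝ) ≤ (g.erase v).card + 1 :=
            mod_cast Nat.sub_le_iff_le_add.1 Finset.pred_card_le_card_erase
          have h2 : (X.card : ℝ) ≤ 2 * g.card := mod_cast hg.2
          nlinarith
        · have h1 : (Y.card : ℝ) ≤ (Y.erase v).card + 1 :=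
            mod_cast Nat.sub_le_iff_le_add.1 Finset.pred_card_le_card_erase
          nlinarith
    -- The events indexed by `g` are disjoint, so averaging over the good set loses no factor.
    _ = μ.real (⋃ g ∈ X.powerset.filter (fun g => X.card ≤ 2 * g.card),
        {G | goods G X s = g}) * Real.exp (-(4 * L)) := by
        rw [measureReal_biUnion_finset, Finset.sum_mul]
        · intro g _ g' _ hgg'
          rw [Function.onFun, Set.disjoint_left]
          exact fun G h h' => hgg' (h.symm.trans h')
        · exact fun _ _ => measurableSet_of_simpleGraph _
    _ ≤ 1 * Real.exp (-(4 * L)) := by gcongr; exact measureReal_le_one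
    _ = _ := one_mul _

end Events

/-! ### Degree and edge counts, and typical graphs. -/

section Concentration

open MeasureTheory

variable {n : ℕ}

theorem exp_two_le_eight : Real.exp 2 ≤ 8 := by
  have h := Real.exp_one_lt_d9
  have h0 := Real.exp_pos 1
  have : Real.exp 2 = Real.exp 1 * Real.exp 1 := by rw [← Real.exp_add]; norm_num
  nlinarith

theorem binomialRandom_real_card_nbhd_inter_ge_le (p : unitInterval) (v : Fin n)
    (Z : Finset (Fin n)) (M : ℕ) (hM : 8 * ((p : ℝ) * Z.card) ≤ (M : ℝ)) :
    (SimpleGraph.binomialRandom (Fin n) p).real {G | M ≤ (nbhd G v ∩ Z).card} ≤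
      Real.exp (-M) := by
  classical
  have hd : Disjoint {v} (Z.erase v) := by simp
  have hp0 := p.2.1
  refine (measureReal_mono ?_ (measure_ne_top _ _)).trans (binomialRandom_real_card_ge_le_exp p
    (crossPairs {v} (Z.erase v)) (fun e he => not_isDiag_of_mem_crossPairs hd he) M ?_)
  · intro G hG
    refine le_trans (b := (nbhd G v ∩ Z).card) hG ?_
    have hsub : (nbhd G v ∩ Z).image (fun w => s(v, w)) ⊆
        (crossPairs {v} (Z.erase v)).filter (· ∈ G.edgeSet) := by
      intro e he
      obtain ⟨w, hw, rfl⟩ := Finset.mem_image.1 he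
      rw [Finset.mem_inter, mem_nbhd] at hw
      refine Finset.mem_filter.2 ⟨mem_crossPairs.2 ⟨v, by simp, w, ?_, rfl⟩, hw.1⟩
      exact Finset.mem_erase.2 ⟨hw.1.ne', hw.2⟩
    rw [← Finset.card_image_of_injective (nbhd G v ∩ Z) (f := fun w => s(v, w))
      fun a b hab => Sym2.congr_right.1 hab]
    exact Finset.card_le_card hsub
  · rw [card_crossPairs hd, Finset.card_singleton, one_mul]
    have h1 : ((Z.erase v).card : ℝ) ≤ Z.card := mod_cast Finset.card_le_card (Finset.erase_subset _ _)
    calc Real.exp 2 * ((Z.erase v).card * p) ≤ 8 * (Z.card * p) := by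
          gcongr; exact exp_two_le_eight
      _ ≤ M := by linarith

theorem binomialRandom_real_ncard_within_ge_le (p : unitInterval)
    (X : Finset (Fin n)) (M : ℕ) (hM : 8 * ((p : ℝ) * X.card ^ 2) ≤ (M : ℝ)) :
    (SimpleGraph.binomialRandom (Fin n) p).real {G | M ≤ (within G X).edgeSet.ncard} ≤
      Real.exp (-M) := by
  classical
  have hp0 := p.2.1
  refine (measureReal_mono ?_ (measure_ne_top _ _)).trans (binomialRandom_real_card_ge_le_exp p
    (X.sym2.filter fun e => ¬ e.IsDiag) (fun e he => (Finset.mem_filter.1 he).2) M ?_)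
  · intro G hG
    refine le_trans (b := (within G X).edgeSet.ncard) hG ?_
    rw [← Set.ncard_coe_finset]
    refine Set.ncard_le_ncard ?_ (Set.toFinite _)
    intro e
    induction e with
    | h u v =>
      rintro ⟨h, hu, hv⟩
      simp only [Finset.coe_filter, Finset.mem_filter, Finset.mk_mem_sym2_iff,
        Sym2.mk_isDiag_iff, Set.mem_ofPred_eq]
      exact ⟨⟨⟨hu, hv⟩, h.ne⟩, h⟩
  · have h1 : ((X.sym2.filter fun e => ¬ e.IsDiag).card : ℝ) ≤ X.card ^ 2 := by
      have h2 : X.sym2.card ≤ X.card ^ 2 := by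
        rw [Finset.card_sym2, Nat.choose_two_right]
        refine Nat.div_le_of_le_mul ?_
        simp only [Nat.add_sub_cancel]
        nlinarith [Nat.zero_le X.card, Nat.le_mul_self X.card]
      exact_mod_cast (Finset.card_filter_le _ _).trans h2
    calc Real.exp 2 * ((X.sym2.filter fun e => ¬ e.IsDiag).card * p) ≤ 8 * (X.card ^ 2 * p) := by
          gcongr; exact exp_two_le_eight
      _ ≤ M := by linarith

/-- The properties of a graph under which the algorithm is correct and makes few probes. -/
structure IsTypical (G : SimpleGraph (Fin n)) (X Y : Finset (Fin n)) (s D a E : ℕ) : Prop where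
  noMediumComponent : NoMediumComponent G X s
  relays_nonempty : ∀ v, (relays G X Y s v).Nonempty
  ncard_within_lt : (within G X).edgeSet.ncard < E
  card_nbhd_lt : ∀ v, (nbhd G v).card < D
  card_nbhd_inter_left_lt : ∀ v, (nbhd G v ∩ X).card < a
  card_nbhd_inter_right_lt : ∀ v, (nbhd G v ∩ Y).card < a

/-- With `ε = 1 / n`, global failures cost `O(ε³)`; per-vertex failures cost at most `ε³` each,
hence `O(ε²)` after a union over `n` vertices. -/
theorem binomialRandom_real_isTypical (p : unitInterval) {X Y : Finset (Fin n)} {s D a E : ℕ}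
    (hn : 8 ≤ n) (hL : 2 ≤ Real.log n) (hp : 1 / (n : ℝ) ≤ p) (hXY : Disjoint X Y)
    (hX : 48 ≤ (p : ℝ) * X.card) (hY : 5 * Real.log n ≤ p * Y.card)
    (hs : Real.log n ≤ s) (hsX : 4 * s ≤ X.card)
    (hD : 8 * ((p : ℝ) * n) ≤ (D : ℝ)) (hD' : 3 * Real.log n ≤ D)
    (haX : 8 * ((p : ℝ) * X.card) ≤ (a : ℝ)) (haY : 8 * ((p : ℝ) * Y.card) ≤ (a : ℝ))
    (ha' : 3 * Real.log n ≤ a) (hE : 8 * ((p : ℝ) * X.card ^ 2) ≤ (E : ℝ)) (hE' : 3 * Real.log n ≤ E) :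
    1 - 1 / (n : ℝ) ≤ (SimpleGraph.binomialRandom (Fin n) p).real
      {G | IsTypical G X Y s D a E} := by
  classical
  set μ := SimpleGraph.binomialRandom (Fin n) p
  set ε : ℝ := 1 / (n : ℝ) with hε
  have hn0 : (0 : ℝ) < n := by positivity
  have hnε : (n : ℝ) * ε = 1 := by rw [hε]; field_simp
  have hε0 : 0 < ε := by positivity
  have hε8 : ε ≤ 1 / 8 := by
    rw [hε]; gcongr; exact_mod_cast hn
  have hexp : ∀ k : ℕ, Real.exp (-(k * Real.log n)) = ε ^ k := by
    intro k
    rw [Real.exp_neg, Real.exp_nat_mul, Real.exp_log hn0, hε]; simp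
  have hexp3 : ∀ M : ℕ, 3 * Real.log n ≤ M → Real.exp (-M) ≤ ε ^ 3 := by
    intro M hM
    rw [← hexp 3]
    exact Real.exp_le_exp.2 (by push_cast; linarith)
  have hXn : (X.card : ℝ) ≤ n := by
    have := Finset.card_le_univ X
    rw [Fintype.card_fin] at this
    exact_mod_cast this
  have hX0 : (0 : ℝ) ≤ X.card := Nat.cast_nonneg _
  let B₁ : Set (SimpleGraph (Fin n)) := {G | ¬ NoMediumComponent G X s}
  let B₂ : Set (SimpleGraph (Fin n)) := {G | ¬ NoBalancedCut G X}
  let B₃ : Set (SimpleGraph (Fin n)) := {G | E ≤ (within G X).edgeSet.ncard}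
  let B₄ (v : Fin n) : Set (SimpleGraph (Fin n)) :=
    {G | X.card ≤ 2 * (goods G X s).card ∧ ¬ (relays G X Y s v).Nonempty}
  let B₅ (v : Fin n) : Set (SimpleGraph (Fin n)) := {G | D ≤ (nbhd G v ∩ Finset.univ).card}
  let B₆ (v : Fin n) : Set (SimpleGraph (Fin n)) := {G | a ≤ (nbhd G v ∩ X).card}
  let B₇ (v : Fin n) : Set (SimpleGraph (Fin n)) := {G | a ≤ (nbhd G v ∩ Y).card}
  have h₁ : μ.real B₁ ≤ 2 * ε ^ 3 := by
    have hs0 : 0 < s := by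
      have : (0 : ℝ) < s := by linarith
      exact_mod_cast this
    have h := binomialRandom_real_not_noMediumComponent_le p X hs0 hX
    have h5 : Real.exp (-(5 * (s : ℝ))) ≤ ε ^ 5 := by
      rw [← hexp 5]
      exact Real.exp_le_exp.2 (by push_cast; linarith)
    -- The lower bound `p ≥ 1 / n` turns the factor `p` into `ε`.
    have h6 : ε * μ.real B₁ ≤ (n + 1) * ε ^ 5 :=
      calc ε * μ.real B₁ ≤ p * μ.real B₁ := by gcongr
        _ ≤ (X.card + 1) * Real.exp (-(5 * s)) := h
        _ ≤ (n + 1) * ε ^ 5 := by gcongr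
    have h7 : ((n : ℝ) + 1) * ε ^ 5 ≤ ε * (2 * ε ^ 3) := by
      have : ((n : ℝ) + 1) * ε ^ 5 = ε ^ 4 * (n * ε + ε) := by ring
      rw [this, hnε]
      have : 0 < ε ^ 4 := by positivity
      nlinarith
    exact le_of_mul_le_mul_left (h6.trans h7) hε0
  have h₂ : μ.real B₂ ≤ ε ^ 3 := by
    refine (binomialRandom_real_not_noBalancedCut_le p X).trans ?_
    have h2 : (2 : ℝ) ^ X.card ≤ Real.exp X.card := by
      have := Real.add_one_le_exp 1
      calc (2 : ℝ) ^ X.card ≤ Real.exp 1 ^ X.card := by gcongr; linarith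
        _ = Real.exp X.card := by rw [← Real.exp_nat_mul, mul_one]
    calc _ ≤ Real.exp X.card * Real.exp (-(p * X.card ^ 2 / 8)) := by gcongr
      _ = Real.exp (X.card - p * X.card ^ 2 / 8) := by rw [← Real.exp_add]; ring_nf
      _ ≤ Real.exp (-((3 : ℕ) * Real.log n)) := by
          refine Real.exp_le_exp.2 ?_
          have h4 : 4 * (s : ℝ) ≤ X.card := mod_cast hsX
          push_cast
          nlinarith
      _ = ε ^ 3 := hexp 3
  have h₃ : μ.real B₃ ≤ ε ^ 3 :=
    (binomialRandom_real_ncard_within_ge_le p X E hE).trans (hexp3 E hE')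
  have h₄ : ∀ v, μ.real (B₄ v) ≤ ε ^ 4 := fun v => by
    have := binomialRandom_real_relays_empty_le p hXY s v hL hX hY
    exact this.trans_eq (hexp 4)
  have h₅ : ∀ v, μ.real (B₅ v) ≤ ε ^ 3 := fun v =>
    (binomialRandom_real_card_nbhd_inter_ge_le p v Finset.univ D (by simpa using hD)).trans
      (hexp3 D hD')
  have h₆ : ∀ v, μ.real (B₆ v) ≤ ε ^ 3 := fun v =>
    (binomialRandom_real_card_nbhd_inter_ge_le p v X a haX).trans (hexp3 a ha')
  have h₇ : ∀ v, μ.real (B₇ v) ≤ ε ^ 3 := fun v =>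
    (binomialRandom_real_card_nbhd_inter_ge_le p v Y a haY).trans (hexp3 a ha')
  have hunion : ∀ (B : Fin n → Set (SimpleGraph (Fin n))) (c : ℝ), (∀ v, μ.real (B v) ≤ c) →
      μ.real (⋃ v ∈ (Finset.univ : Finset (Fin n)), B v) ≤ n * c := fun B c h =>
    (measureReal_biUnion_finset_le _ _).trans
      ((Finset.sum_le_sum fun v _ => h v).trans_eq (by simp))
  have hcompl : {G | IsTypical G X Y s D a E}ᶜ ⊆
      B₁ ∪ (B₂ ∪ (B₃ ∪ ((⋃ v ∈ (Finset.univ : Finset (Fin n)), B₄ v) ∪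
        ((⋃ v ∈ (Finset.univ : Finset (Fin n)), B₅ v) ∪
        ((⋃ v ∈ (Finset.univ : Finset (Fin n)), B₆ v) ∪
          (⋃ v ∈ (Finset.univ : Finset (Fin n)), B₇ v)))))) := by
    intro G hG
    by_contra hcon
    simp only [Set.mem_union, Set.mem_iUnion, not_or, not_exists, Finset.mem_univ, B₁, B₂, B₃, B₄,
      B₅, B₆, B₇, Set.mem_ofPred_eq, not_not, not_le, not_and, forall_true_left,
      Finset.inter_univ] at hcon
    obtain ⟨c1, c2, c3, c4, c5, c6, c7⟩ := hcon
    -- The absence of balanced cuts supplies the many good vertices presupposed in `B₄`.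
    exact hG ⟨c1, fun v => c4 v (card_le_two_mul_card_goods hsX c2), c3, c5, c6, c7⟩
  have hbad : μ.real {G | IsTypical G X Y s D a E}ᶜ ≤ ε := by
    refine (measureReal_mono hcompl (measure_ne_top _ _)).trans ?_
    have hle := fun S T : Set (SimpleGraph (Fin n)) => measureReal_union_le (μ := μ) S T
    calc _ ≤ 2 * ε ^ 3 + (ε ^ 3 + (ε ^ 3 + (n * ε ^ 4 + (n * ε ^ 3 + (n * ε ^ 3 + n * ε ^ 3))))) := by
          refine (hle _ _).trans (add_le_add h₁ ((hle _ _).trans (add_le_add h₂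
            ((hle _ _).trans (add_le_add h₃ ((hle _ _).trans (add_le_add (hunion _ _ h₄)
            ((hle _ _).trans (add_le_add (hunion _ _ h₅) ((hle _ _).trans
            (add_le_add (hunion _ _ h₆) (hunion _ _ h₇))))))))))))
      _ = 5 * ε ^ 3 + 3 * ε ^ 2 := by
          linear_combination (ε ^ 3 + 3 * ε ^ 2) * hnε
      _ ≤ ε := by nlinarith [mul_pos hε0 hε0]
  rw [probReal_compl_eq_one_sub (measurableSet_of_simpleGraph _)] at hbad
  linarith

end Concentration

/-! ### The truncated algorithm. -/

section Algorithm

variable {n : ℕ}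

/-- The algorithm that decides adjacency in `sparseSubgraph` and gives up after `b` probes. -/
noncomputable def sparseLCA (X Y : Finset (Fin n)) (s b : ℕ) : LCA n where
  tapeLength := 0
  procedure _ q := ProbeTree.trunc false b (ProbeTree.adjProc X Y s q.1 q.2)

theorem sparseLCA_worstCaseProbeComplexityLE (X Y : Finset (Fin n)) (s b : ℕ) :
    (sparseLCA X Y s b).WorstCaseProbeComplexityLE b := by
  intro I
  refine Real.iSup_le (fun q => ?_) (Nat.cast_nonneg b)
  unfold LCA.expectedProbes
  rw [div_le_iff₀ (by positivity)]
  have h : ∀ r : Fin (sparseLCA X Y s b).tapeLength → Bool,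
      (((sparseLCA X Y s b).procedure r q).probes I : ℝ) ≤ b := fun r =>
    mod_cast ProbeTree.probes_trunc_le I false b _
  refine (Finset.sum_le_sum fun r _ => h r).trans_eq ?_
  simp [mul_comm]

/-- On a typical graph the budget is never exceeded, so truncation leaves the answers intact. -/
theorem sparseLCA_solves {X Y : Finset (Fin n)} {s D a E b : ℕ} (hn : 0 < n)
    (hb : D + 2 * (D * (1 + a * s * s) + D * (1 + a * (1 + a * s * s))) ≤ b)
    {r : ℝ} (hr : (E : ℝ) ≤ r) (I : GraphInput n) (hI : IsTypical I.graph X Y s D a E) :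
    (sparseLCA X Y s b).Solves (SparseConnectedSubgraph ((n : ℝ) + r)) I := by
  intro t
  refine ⟨sparseSubgraph I.graph X Y s, sparseConnectedSubgraph_sparseSubgraph hn
    hI.noMediumComponent hI.relays_nonempty ?_, fun u v => ?_⟩
  · exact le_trans (mod_cast hI.ncard_within_lt.le) hr
  · rw [← ProbeTree.run_adjProc]
    unfold LCA.output sparseLCA
    rw [ProbeTree.run_trunc]
    exact (ProbeTree.probes_adjProc_le (fun v => hI.card_nbhd_lt v)
      (fun v => (hI.card_nbhd_inter_left_lt v).le)
      (fun v => (hI.card_nbhd_inter_right_lt v).le) u v).trans hb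

end Algorithm

/-! ### Choice of parameters and asymptotics. -/

section Parameters

/-- The core must have few edges and yet at least `4 s` vertices. For `np ≤ log³ n`, `p` is so small
that `k = (log n) ^ (1 / 4)` suffices; for larger `np`, `k = 40 log n` is affordable and works up to
`p = 1`. The threshold is `48 ^ 4`. -/
theorem exists_core_density {n : ℕ} {p : unitInterval} (hL : 5308416 ≤ Real.log n)
    (hn : (4 * Real.log n + 4) * Real.log n ^ 3 ≤ n) (hp : 7 * Real.log n / n ≤ p) :
    ∃ k : ℝ, 48 ≤ k ∧ k ≤ 40 * Real.log n ∧ k ^ 2 / p ≤ 1600 * (n / √(Real.log n)) ∧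
      (k + 5 * Real.log n) / p + 2 ≤ n ∧ 4 * Real.log n + 4 ≤ k / p := by
  set L := Real.log n
  have hn0 : (0 : ℝ) < n := by
    refine lt_of_lt_of_le ?_ hn
    positivity
  have hn14 : (14 : ℝ) ≤ n := by
    refine le_trans ?_ hn
    have : 1 ≤ L ^ 3 := one_le_pow₀ (by linarith)
    nlinarith
  have hL0 : 0 < L := by linarith
  have hp0 : (0 : ℝ) < p := lt_of_lt_of_le (by positivity) hp
  have hnp : 7 * L ≤ n * p := by rwa [div_le_iff₀ hn0, mul_comm (p : ℝ)] at hp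
  set S := √L
  have hS0 : 0 < S := Real.sqrt_pos.2 hL0
  have hSS : S * S = L := Real.mul_self_sqrt hL0.le
  have hS : 2304 ≤ S := Real.le_sqrt_of_sq_le (by norm_num; exact hL)
  rcases le_total ((n : ℝ) * p) (L ^ 3) with hsparse | hdense
  · have hR : √S * √S = S := Real.mul_self_sqrt hS0.le
    have hR48 : 48 ≤ √S := Real.le_sqrt_of_sq_le (by norm_num; exact hS)
    have hRL : √S ≤ L := by nlinarith
    refine ⟨√S, hR48, by linarith, ?_, ?_, ?_⟩
    · rw [pow_two, hR, div_le_iff₀ hp0]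
      have : 1600 * (n / S) * p = 1600 * (n * p) / S := by ring
      rw [this, le_div_iff₀ hS0, hSS]
      linarith
    -- The numerator is at most `6 L` and `np ≥ 7 L`, so `n / 7 ≥ 2` vertices remain for rounding.
    · have : (√S + 5 * L) / p ≤ 6 / 7 * n := by
        rw [div_le_iff₀ hp0]
        linarith
      linarith
    · rw [le_div_iff₀ hp0]
      have h1 : (4 * L + 4) * p * L ^ 3 ≤ L ^ 3 :=
        calc (4 * L + 4) * p * L ^ 3 = (4 * L + 4) * L ^ 3 * p := by ring
          _ ≤ (n : ℝ) * p := by gcongr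
          _ ≤ L ^ 3 := hsparse
      have h2 : 0 < L ^ 3 := by positivity
      have h3 : (4 * L + 4) * p ≤ 1 := by
        by_contra hcon
        nlinarith
      linarith
  · have hp1 := p.2.2
    refine ⟨40 * L, by linarith, le_rfl, ?_, ?_, ?_⟩
    · rw [div_le_iff₀ hp0]
      have : 1600 * (n / S) * p = 1600 * (n * p) / S := by ring
      rw [this, le_div_iff₀ hS0]
      have : S ≤ L := by nlinarith
      have h2 : 0 < L ^ 2 := by positivity
      nlinarith
    · have : (40 * L + 5 * L) / p ≤ 6 / 7 * n := by
        rw [div_le_iff₀ hp0]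
        have : 100 * L ≤ L ^ 3 := by nlinarith [mul_pos hL0 hL0]
        linarith
      linarith
    · rw [le_div_iff₀ hp0]
      nlinarith

theorem exists_disjoint_card {n x y : ℕ} (h : x + y ≤ n) :
    ∃ X Y : Finset (Fin n), Disjoint X Y ∧ X.card = x ∧ Y.card = y := by
  obtain ⟨X, -, hX⟩ := Finset.exists_subset_card_eq
    (s := (Finset.univ : Finset (Fin n))) (n := x) (by rw [Finset.card_fin]; omega)
  obtain ⟨Y, hYX, hY⟩ := Finset.exists_subset_card_eq (s := Xᶜ) (n := y)
    (by rw [Finset.card_compl, Fintype.card_fin]; omega)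
  exact ⟨X, Y, Finset.disjoint_left.2 fun v hv hv' => Finset.mem_compl.1 (hYX hv') hv, hX, hY⟩

theorem probe_budget_le {D a s L Δ : ℝ} (hL : 1 ≤ L) (hΔ : 0 ≤ Δ) (ha0 : 0 ≤ a) (hs0 : 0 ≤ s)
    (hD : D ≤ 9 * Δ) (ha : a ≤ 401 * L) (hs : s ≤ 2 * L) :
    D + 2 * (D * (1 + a * s * s) + D * (1 + a * (1 + a * s * s))) ≤ 12000000 * Δ * L ^ 4 := by
  have hL0 : 0 ≤ L := by linarith
  have hL3 : 1 ≤ L ^ 3 := one_le_pow₀ hL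
  have hL4 : 1 ≤ L ^ 4 := one_le_pow₀ hL
  have hc : 1 + a * s * s ≤ 1605 * L ^ 3 :=
    calc 1 + a * s * s ≤ L ^ 3 + 401 * L * (2 * L) * (2 * L) := by gcongr
      _ = 1605 * L ^ 3 := by ring
  have ha1 : 1 + a ≤ 402 * L := by linarith
  have hc0 : 0 ≤ 1 + a * s * s := by positivity
  calc D + 2 * (D * (1 + a * s * s) + D * (1 + a * (1 + a * s * s)))
      = D * (3 + 2 * ((1 + a * s * s) * (1 + a))) := by ring
    _ ≤ 9 * Δ * (3 * L ^ 4 + 2 * ((1605 * L ^ 3) * (402 * L))) := by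
        gcongr
        linarith
    _ ≤ 12000000 * Δ * L ^ 4 := by
        have : 0 ≤ Δ * L ^ 4 := by positivity
        nlinarith

theorem isLittleO_edge_excess :
    (fun n : ℕ => 51200 * ((n : ℝ) / √(Real.log n)) + 3 * Real.log n + 1)
      =o[atTop] (fun n : ℕ => (n : ℝ)) := by
  have hcast : Tendsto (fun n : ℕ => (n : ℝ)) atTop atTop := tendsto_natCast_atTop_atTop
  have hlog : Tendsto (fun n : ℕ => Real.log n) atTop atTop := Real.tendsto_log_atTop.comp hcast
  refine ((IsLittleO.const_mul_left ?_ _).add (IsLittleO.const_mul_left ?_ _)).add ?_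
  · have h : Tendsto (fun n : ℕ => (√(Real.log n))⁻¹) atTop (nhds 0) :=
      tendsto_inv_atTop_zero.comp (Real.tendsto_sqrt_atTop.comp hlog)
    have h1 : (fun n : ℕ => (√(Real.log n))⁻¹) =o[atTop] (fun _ : ℕ => (1 : ℝ)) :=
      (isLittleO_one_iff ℝ).2 h
    simpa [div_eq_mul_inv] using (isBigO_refl (fun n : ℕ => (n : ℝ)) atTop).mul_isLittleO h1
  · exact Real.isLittleO_log_id_atTop.comp_tendsto hcast
  · exact (isLittleO_const_id_atTop (1 : ℝ)).comp_tendsto hcast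

theorem eventually_log_pow_le :
    ∀ᶠ n : ℕ in atTop, (4 * Real.log n + 4) * Real.log n ^ 3 ≤ n := by
  have hcast : Tendsto (fun n : ℕ => (n : ℝ)) atTop atTop := tendsto_natCast_atTop_atTop
  have h4 := (Real.isLittleO_pow_log_id_atTop (n := 4)).comp_tendsto hcast
  filter_upwards [h4.bound (show (0 : ℝ) < 1 / 8 by norm_num),
    (Real.tendsto_log_atTop.comp hcast).eventually_ge_atTop 1] with n hn hL
  simp only [Function.comp_apply, id_eq, Real.norm_eq_abs, Nat.abs_cast] at hn hL
  rw [abs_of_nonneg (by positivity)] at hn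
  have h3 : 0 < Real.log n ^ 3 := by positivity
  nlinarith

end Parameters

/-! ### Assembly of the theorem. -/

theorem theorem1p7 :
    ∃ (C : ℝ) (k : ℕ) (err : ℕ → ℝ), err =o[atTop] (fun n : ℕ => (n : ℝ)) ∧
      ∀ᶠ n : ℕ in atTop, ∀ p : unitInterval, 7 * Real.log n / n ≤ (p : ℝ) →
        ∃ A : LCA n,
          A.IsAverageCase p (SparseConnectedSubgraph ((n : ℝ) + err n)) ∧
          A.WorstCaseProbeComplexityLE (C * ((n : ℝ) * (p : ℝ)) * Real.log n ^ k) := by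
  refine ⟨12000000, 4, _, isLittleO_edge_excess, ?_⟩
  have hlog : Tendsto (fun n : ℕ => Real.log n) atTop atTop :=
    Real.tendsto_log_atTop.comp tendsto_natCast_atTop_atTop
  filter_upwards [eventually_log_pow_le, hlog.eventually_ge_atTop 5308416,
    eventually_ge_atTop 8] with n hn hL hn8 p hp
  obtain ⟨k, hk48, hkL, hkE, hkn, hks⟩ := exists_core_density hL hn hp
  set L := Real.log n with hLdef
  have hn0 : (0 : ℝ) < n := by positivity
  have hL0 : 0 < L := by linarith
  have hp0 : (0 : ℝ) < p := lt_of_lt_of_le (by positivity) hp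
  have hp1 : (p : ℝ) ≤ 1 := p.2.2
  have hnp : 7 * L ≤ n * p := by rwa [div_le_iff₀ hn0, mul_comm (p : ℝ)] at hp
  have hx := Nat.le_ceil (k / p)
  have hx' := (Nat.ceil_lt_add_one (show 0 ≤ k / p by positivity)).le
  have hy := Nat.le_ceil (5 * L / p)
  have hy' := (Nat.ceil_lt_add_one (show 0 ≤ 5 * L / p by positivity)).le
  obtain ⟨X, Y, hXY, hX, hY⟩ := exists_disjoint_card (n := n) (x := ⌈k / p⌉₊) (y := ⌈5 * L / p⌉₊) <| by
    have : (⌈k / p⌉₊ : ℝ) + ⌈5 * L / p⌉₊ ≤ n := by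
      rw [add_div] at hkn
      linarith
    exact_mod_cast this
  rw [← hX] at hx hx'
  rw [← hY] at hy hy'
  have hpk : (p : ℝ) * (k / p) = k := by field_simp
  have hpL : (p : ℝ) * (5 * L / p) = 5 * L := by field_simp
  have hpX : k ≤ p * X.card := hpk ▸ mul_le_mul_of_nonneg_left hx hp0.le
  have hpX' : (p : ℝ) * X.card ≤ k + 1 := by nlinarith [mul_le_mul_of_nonneg_left hx' hp0.le]
  have hpY : 5 * L ≤ p * Y.card := hpL ▸ mul_le_mul_of_nonneg_left hy hp0.le
  have hpY' : (p : ℝ) * Y.card ≤ 5 * L + 1 := by nlinarith [mul_le_mul_of_nonneg_left hy' hp0.le]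
  -- Together with `8` from the tail bound and `1600` from the choice of `k`, this gives the
  -- coefficient `51200 = 8 * 4 * 1600` of the edge excess.
  have hpX2 : (p : ℝ) * X.card ^ 2 ≤ 4 * (k ^ 2 / p) := by
    rw [mul_div_assoc', le_div_iff₀ hp0]
    calc (p : ℝ) * X.card ^ 2 * p = (p * X.card) ^ 2 := by ring
      _ ≤ (k + 1) ^ 2 := by gcongr
      _ ≤ 4 * k ^ 2 := by nlinarith
  have hs := Nat.le_ceil L
  have hs' := (Nat.ceil_lt_add_one hL0.le).le
  have hD := Nat.le_ceil (8 * ((p : ℝ) * n))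
  have hD' := (Nat.ceil_lt_add_one (show 0 ≤ 8 * ((p : ℝ) * n) by positivity)).le
  -- It covers `8 (k + 1)` with `k ≤ 40 L` and `8 (5 L + 1)`, the tail thresholds for degrees into
  -- `X` and `Y`.
  have ha := Nat.le_ceil (400 * L)
  have ha' := (Nat.ceil_lt_add_one (show 0 ≤ 400 * L by positivity)).le
  have hE0 : 0 ≤ (p : ℝ) * X.card ^ 2 := by positivity
  have hE := Nat.le_ceil (8 * ((p : ℝ) * X.card ^ 2) + 3 * L)
  have hE' := (Nat.ceil_lt_add_one
    (show 0 ≤ 8 * ((p : ℝ) * X.card ^ 2) + 3 * L by positivity)).le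
  set s := ⌈L⌉₊
  set D := ⌈8 * ((p : ℝ) * n)⌉₊
  set a := ⌈400 * L⌉₊
  set E := ⌈8 * ((p : ℝ) * X.card ^ 2) + 3 * L⌉₊
  refine ⟨sparseLCA X Y s (D + 2 * (D * (1 + a * s * s) + D * (1 + a * (1 + a * s * s)))), ?_, ?_⟩
  · refine (binomialRandom_real_isTypical p (D := D) (a := a) (E := E) (s := s) hn8 (by linarith) ?_
      hXY (by linarith) hpY hs ?_ hD (by linarith) (by linarith) (by linarith) (by linarith)
      (by linarith) (by linarith)).trans
      (MeasureTheory.measureReal_mono ?_ (MeasureTheory.measure_ne_top _ _))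
    · refine le_trans ?_ hp
      gcongr
      linarith
    · have : 4 * (s : ℝ) ≤ X.card := by linarith
      exact_mod_cast this
    · rintro G hG J rfl
      refine sparseLCA_solves (by omega) le_rfl ?_ J hG
      linarith
  · intro I
    refine (sparseLCA_worstCaseProbeComplexityLE X Y s _ I).trans ?_
    push_cast
    exact probe_budget_le (by linarith) (by positivity) (by positivity) (by positivity)
      (by linarith) (by linarith) (by linarith)
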